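/- Let $m\ge 1$ and $l\ge 0$ be integers, and let $h\colon\mathbb{R}^{m+l}\to\mathbb{R}^{l}$ and $f\colon\mathbb{R}^{m+l}\to\mathbb{R}^{2m-1}$ be smooth ($C^\infty$) maps such that $\operatorname{rank} dh(x)=l$ for every $x\in h^{-1}(0)$, so that $h^{-1}(0)$, if non-empty, is a smooth $m$-dimensional submanifold of $\mathbb{R}^{m+l}$. Let $\mu\colon\mathbb{R}^{m+l}\to\mathbb{R}^{s}$, $s=\binom{2m-1+l}{m+l}$, be the map whose components at $x$ are all the $(m+l)\times(m+l)$ minors of the $(2m-1+l)\times(m+l)$ Jacobian matrix $d(h,f)(x)$. Let $p\in h^{-1}(0)$. Then $$\operatorname{rank} d\bigl(f|h^{-1}(0)\bigr)(p)=m-1\iff \operatorname{rank} d(h,f)(p)=m-1+l .$$ Moreover, if $\operatorname{rank} d\bigl(f|h^{-1}(0)\bigr)(p)=m-1$, then $p$ is a cross-cap of $f|h^{-1}(0)$ if and only if $p$ is a regular zero of $\mu|h^{-1}(0)$. Here $p$ is a cross-cap of a smooth map $g\colon M\to\mathbb{R}^{2m-1}$ on an $m$-dimensional manifold $M$ if there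 are smooth coordinate systems on $M$ centred at $p$ and on $\mathbb{R}^{2m-1}$ centred at $g(p)$ in which $g$ has, near $p$, the form $$(x_1,\ldots,x_m)\mapsto(x_1^2,x_2,\ldots,x_m,x_1x_2,\ldots,x_1x_m);$$ and $p$ is a regular zero of $\mu|h^{-1}(0)$ if $\mu(p)=0$ and $\operatorname{rank} d\bigl(\mu|h^{-1}(0)\bigr)(p)=m$. -/

import Mathlib

open scoped ContDiff Topology

noncomputable section

/-- The Jacobian matrix of `g : ℝⁿ → ℝᵏ` at `x`, with `k` rows and `n` columns. -/
def jacobian {n k : ℕ} (g : EuclideanSpace ℝ (Fin n) → EuclideanSpace ℝ (Fin k))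
    (x : EuclideanSpace ℝ (Fin n)) : Matrix (Fin k) (Fin n) ℝ :=
  Matrix.of fun i j => fderiv ℝ g x (EuclideanSpace.single j 1) i

/-- The map `(h, f) : ℝⁿ → ℝˡ⁺ᵏ` whose components are those of `h` followed by those of `f`. -/
def pairMap {n l k : ℕ} (h : EuclideanSpace ℝ (Fin n) → EuclideanSpace ℝ (Fin l))
    (f : EuclideanSpace ℝ (Fin n) → EuclideanSpace ℝ (Fin k)) :
    EuclideanSpace ℝ (Fin n) → EuclideanSpace ℝ (Fin (l + k)) :=
  fun x => WithLp.toLp 2 (Fin.append (fun i => h x i) (fun i => f x i))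

/-- All `n × n` minors of a matrix `A` with `k` rows and `n` columns: there is one component for
each set of `n` rows, the rows being taken in increasing order. -/
def maximalMinors {n k : ℕ} (A : Matrix (Fin k) (Fin n) ℝ) :
    EuclideanSpace ℝ {s : Finset (Fin k) // s.card = n} :=
  WithLp.toLp 2 fun s => (A.submatrix (s.1.orderEmbOfFin s.2) id).det

/-- The set `h⁻¹(0)`. -/
def zeroSet {n l : ℕ} (h : EuclideanSpace ℝ (Fin n) → EuclideanSpace ℝ (Fin l)) :
    Set (EuclideanSpace ℝ (Fin n)) :=
  {x | h x = 0}

/-- The tangent space at `p` of `h⁻¹(0)`, when `dh(p)` is onto: the kernel of `dh(p)`. -/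
def tangentZeroSet {n l : ℕ} (h : EuclideanSpace ℝ (Fin n) → EuclideanSpace ℝ (Fin l))
    (p : EuclideanSpace ℝ (Fin n)) : Submodule ℝ (EuclideanSpace ℝ (Fin n)) :=
  LinearMap.ker (fderiv ℝ h p).toLinearMap

/-- The rank of `d(g|h⁻¹(0))(p)`, that is, of `dg(p)` restricted to the tangent space at `p`
of `h⁻¹(0)`. -/
def rankOnZeroSet {n l : ℕ} {ι : Type*} [Fintype ι]
    (h : EuclideanSpace ℝ (Fin n) → EuclideanSpace ℝ (Fin l))
    (g : EuclideanSpace ℝ (Fin n) → EuclideanSpace ℝ ι) (p : EuclideanSpace ℝ (Fin n)) : ℕ :=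
  Module.finrank ℝ
    (LinearMap.range ((fderiv ℝ g p).toLinearMap.domRestrict (tangentZeroSet h p)))

/-- `p` is a regular zero of the restriction of `g` to the `m`-dimensional manifold `h⁻¹(0)`:
`g` vanishes at `p` and the differential of the restriction has rank `m` there. -/
def IsRegularZeroOnZeroSet {n l : ℕ} {ι : Type*} [Fintype ι] (m : ℕ)
    (h : EuclideanSpace ℝ (Fin n) → EuclideanSpace ℝ (Fin l))
    (g : EuclideanSpace ℝ (Fin n) → EuclideanSpace ℝ ι) (p : EuclideanSpace ℝ (Fin n)) : Prop :=
  g p = 0 ∧ rankOnZeroSet h g p = m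

/-- `φ` is a smooth coordinate system on an open part of the `m`-dimensional submanifold `M` of
`ℝⁿ`: a homeomorphism from an open subset of `M` onto an open subset of `ℝᵐ`, whose inverse is a
smooth immersion into `ℝⁿ`. -/
structure IsSmoothCoord {n m : ℕ} (M : Set (EuclideanSpace ℝ (Fin n)))
    (φ : OpenPartialHomeomorph M (EuclideanSpace ℝ (Fin m))) : Prop where
  contDiffOn_symm :
    ContDiffOn ℝ ∞ (fun x => (φ.symm x : EuclideanSpace ℝ (Fin n))) φ.target
  injective_fderiv : ∀ x ∈ φ.target,
    Function.Injective (fderiv ℝ (fun y => (φ.symm y : EuclideanSpace ℝ (Fin n))) x)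

/-- `(x₁, …, x_m) ↦ (x₁², x₂, …, x_m, x₁ x₂, …, x₁ x_m)`, with indices counted from `0`. -/
def crossCapForm (m : ℕ) (x : EuclideanSpace ℝ (Fin m)) : EuclideanSpace ℝ (Fin (2 * m - 1)) :=
  WithLp.toLp 2 fun i : Fin (2 * m - 1) =>
    if i.1 = 0 then x ⟨0, by have := i.2; omega⟩ ^ 2
    else if hi : i.1 < m then x ⟨i.1, hi⟩
    else x ⟨0, by omega⟩ * x ⟨i.1 - m + 1, by omega⟩

/-- `p` is a cross-cap of the map `f : M → ℝ²ᵐ⁻¹` on the `m`-dimensional submanifold `M` of `ℝⁿ`: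
in suitable smooth coordinates on `M` centred at `p` and on `ℝ²ᵐ⁻¹` centred at `f p`, the map `f`
has the form `crossCapForm m` near `p`. -/
def IsCrossCap {n m : ℕ} (M : Set (EuclideanSpace ℝ (Fin n)))
    (f : M → EuclideanSpace ℝ (Fin (2 * m - 1))) (p : M) : Prop :=
  ∃ (φ : OpenPartialHomeomorph M (EuclideanSpace ℝ (Fin m)))
    (ψ : OpenPartialHomeomorph (EuclideanSpace ℝ (Fin (2 * m - 1)))
      (EuclideanSpace ℝ (Fin (2 * m - 1)))),
    IsSmoothCoord M φ ∧ p ∈ φ.source ∧ φ p = 0 ∧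
    ContDiffOn ℝ ∞ ψ ψ.source ∧ ContDiffOn ℝ ∞ ψ.symm ψ.target ∧
    f p ∈ ψ.source ∧ ψ (f p) = 0 ∧
    ∀ᶠ x in 𝓝 (0 : EuclideanSpace ℝ (Fin m)),
      x ∈ φ.target ∧ f (φ.symm x) ∈ ψ.source ∧ ψ (f (φ.symm x)) = crossCapForm m x

end

/-!
The proof has an algebraic and a local analytic half, which meet in the notion of a germ with
non-degenerate intrinsic second derivative (`IsNondegenerateAt`): `dg` has a kernel, and for `v ≠ 0`
in it the map `u ↦ d²g(u, v)` into the cokernel of `dg` is injective. By the chain rule this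
condition is invariant under changes of coordinates in source and target
(`IsNondegenerateAt.of_germEquiv`).

Algebraic half. Let `G = (h, f)` have rank `m - 1 + l` at `p`, so that `ker dG(p)` is a line, spanned
by some `v`. Differentiating `adj M · M v = det M • v` and using Cramer's rule shows that the
derivative of the maximal minors of `dG` in the direction `u` vanishes if and only if `d²G(u, v)` lies
in the image of `dG(p)` (`fderiv_maximalMinors_eq_zero_iff`). In a coordinate system of `h⁻¹(0)` with
inverse `γ`, this says that `p` is a regular zero of the minors on `h⁻¹(0)` if and only if `f ∘ γ` is
non-degenerate (`isNondegenerateAt_iff_isRegularZeroOnZeroSet`).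

Analytic half. The standard cross-cap is non-degenerate by direct computation, so every cross-cap is.
Conversely, a non-degenerate map of corank one is a cross-cap; this is Whitney's normal form
(`germEquiv_whitneyUmbrella_of_isNondegenerateAt`). Up to coordinates the map is
`(t, y) ↦ (y, c (t, y))` with `dc(0) = 0`, and the Morse lemma with parameters turns one component of
`c` into `t ^ 2` (`exists_germEquiv_sq`). The other components are split as
`A (t ^ 2, y) + t B (t ^ 2, y)`. The first summand is a smooth function of the components `t ^ 2` and
`y`, hence is removed in the target; non-degeneracy says that `y ↦ B (0, y)` is a local
diffeomorphism, hence `B` may be taken as the new variable `y`.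

The splitting is Whitney's theorem on even and odd functions
(`SmoothNear.exists_eq_even_add_odd`). The functions `A` and `B` must also be smooth where the first
argument is negative. They come from the Fourier inversion formula for a cut-off of the function, in
which `cos (t ξ)` is replaced by `C (t ^ 2 ξ ^ 2)` and `sin (t ξ)` by
`-2 t ξ C' (t ^ 2 ξ ^ 2)`, where `C` is a smooth function on the whole line with bounded derivatives
and `C (x ^ 2) = cos x`.
-/

/-! ### Smooth dependence of integrals on a parameter -/

open MeasureTheory in
theorem hasFDerivAt_integral_of_iteratedFDeriv_bound {P W H : Type*}
    [NormedAddCommGroup P] [NormedSpace ℝ P] [NormedAddCommGroup W] [NormedSpace ℝ W]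
    [MeasurableSpace W] [BorelSpace W] [SecondCountableTopology W] {μ : Measure W}
    [NormedAddCommGroup H] [NormedSpace ℝ H] {q : P → W → H}
    (hq : ContDiff ℝ ∞ (Function.uncurry q))
    (hb : ∀ k : ℕ, ∃ b : W → ℝ, Integrable b μ ∧
      ∀ᵐ w ∂μ, ∀ p, ‖iteratedFDeriv ℝ k (fun p => q p w) p‖ ≤ b w) :
    ContDiff ℝ ∞ (Function.uncurry fun p w => fderiv ℝ (fun p => q p w) p) ∧
      ∀ p, HasFDerivAt (fun p => ∫ w, q p w ∂μ) (∫ w, fderiv ℝ (fun p => q p w) p ∂μ) p := by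
  have hd : ContDiff ℝ ∞ (Function.uncurry fun p w => fderiv ℝ (fun p => q p w) p) := by
    refine ContDiff.fderiv (f := fun (x : P × W) p' => q p' x.2) (m := ∞) ?_ contDiff_fst (by simp)
    exact hq.comp (contDiff_snd.prodMk (contDiff_snd.comp contDiff_fst))
  have hs : ∀ w, ContDiff ℝ ∞ (fun p => q p w) := fun w =>
    hq.comp (contDiff_id.prodMk contDiff_const)
  have cont : ∀ p, AEStronglyMeasurable (q p) μ := fun p =>
    (hq.continuous.comp (by fun_prop : Continuous fun w => (p, w))).aestronglyMeasurable
  refine ⟨hd, fun p => ?_⟩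
  have contd : AEStronglyMeasurable (fun w => fderiv ℝ (fun p => q p w) p) μ :=
    (hd.continuous.comp (by fun_prop : Continuous fun w => (p, w))).aestronglyMeasurable
  obtain ⟨b0, hb0, hb0'⟩ := hb 0
  obtain ⟨b1, hb1, hb1'⟩ := hb 1
  refine hasFDerivAt_integral_of_dominated_of_fderiv_le (s := Set.univ) (bound := b1)
    (F' := fun p w => fderiv ℝ (fun p => q p w) p)
    Filter.univ_mem (Filter.Eventually.of_forall cont) ?_ contd ?_ hb1 ?_
  · refine hb0.mono' (cont p) ?_
    filter_upwards [hb0'] with w hw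
    simpa using hw p
  · filter_upwards [hb1'] with w hw p _
    rw [← norm_iteratedFDeriv_one]
    exact hw p
  · exact Filter.Eventually.of_forall fun w p _ =>
      ((hs w).differentiable (by simp) p).hasFDerivAt

open MeasureTheory in
/-- Differentiation under the integral sign to all orders, when each derivative of the integrand in
the parameter has an integrable bound that does not depend on the parameter. -/
theorem contDiff_integral_of_iteratedFDeriv_bound.{u, v} {P : Type u} {W : Type v}
    [NormedAddCommGroup P] [NormedSpace ℝ P] [NormedAddCommGroup W] [NormedSpace ℝ W]
    [MeasurableSpace W] [BorelSpace W] [SecondCountableTopology W] {μ : Measure W} {H : Type u}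
    [NormedAddCommGroup H] [NormedSpace ℝ H] {q : P → W → H}
    (hq : ContDiff ℝ ∞ (Function.uncurry q))
    (hb : ∀ k : ℕ, ∃ b : W → ℝ, Integrable b μ ∧
      ∀ᵐ w ∂μ, ∀ p, ‖iteratedFDeriv ℝ k (fun p => q p w) p‖ ≤ b w) :
    ContDiff ℝ ∞ (fun p => ∫ w, q p w ∂μ) := by
  suffices main : ∀ (n : ℕ) (H : Type u) [NormedAddCommGroup H] [NormedSpace ℝ H] (q : P → W → H),
      ContDiff ℝ ∞ (Function.uncurry q) →
      (∀ k : ℕ, ∃ b : W → ℝ, Integrable b μ ∧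
        ∀ᵐ w ∂μ, ∀ p, ‖iteratedFDeriv ℝ k (fun p => q p w) p‖ ≤ b w) →
      ContDiff ℝ n (fun p => ∫ w, q p w ∂μ) from
    contDiff_infty.2 fun n => main n H q hq hb
  intro n
  induction n with
  | zero =>
    intro H _ _ q hq hb
    have := (hasFDerivAt_integral_of_iteratedFDeriv_bound hq hb).2
    exact contDiff_zero.2 (continuous_iff_continuousAt.2 fun p => (this p).continuousAt)
  | succ n ih =>
    intro H _ _ q hq hb
    obtain ⟨hd, hf⟩ := hasFDerivAt_integral_of_iteratedFDeriv_bound hq hb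
    refine contDiff_succ_iff_hasFDerivAt.2 ⟨_, ih _ _ hd fun k => ?_, hf⟩
    obtain ⟨b, hb, hb'⟩ := hb (k + 1)
    refine ⟨b, hb, ?_⟩
    filter_upwards [hb'] with w hw p
    exact norm_iteratedFDeriv_fderiv.trans_le (hw p)

theorem norm_iteratedFDeriv_comp_clm_le {P Q H : Type*}
    [NormedAddCommGroup P] [NormedSpace ℝ P] [NormedAddCommGroup Q] [NormedSpace ℝ Q]
    [NormedAddCommGroup H] [NormedSpace ℝ H] {κ : Q → H} (hκ : ContDiff ℝ ∞ κ) (T : P →L[ℝ] Q)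
    (k : ℕ) {M : ℝ} (hM : ∀ x, ‖iteratedFDeriv ℝ k κ x‖ ≤ M) (p : P) :
    ‖iteratedFDeriv ℝ k (fun p => κ (T p)) p‖ ≤ M * ‖T‖ ^ k := by
  have := T.iteratedFDeriv_comp_right (n := k) (hκ.of_le (by exact_mod_cast le_top)) p le_rfl
  change ‖iteratedFDeriv ℝ k (κ ∘ T) p‖ ≤ _
  rw [this]
  refine (ContinuousMultilinearMap.norm_compContinuousLinearMap_le _ _).trans ?_
  simp only [Finset.prod_const, Finset.card_univ, Fintype.card_fin]
  gcongr
  exact hM _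

/-! ### Maps that are smooth near a point, and Hadamard's lemma -/

/-- `f` is `C^∞` on a neighbourhood of `x`. This is stronger than `ContDiffAt ℝ ∞ f x`, which only
gives, for each finite `n`, a neighbourhood (depending on `n`) on which `f` is `C^n`. -/
def SmoothNear {E F : Type*} [NormedAddCommGroup E] [NormedSpace ℝ E] [NormedAddCommGroup F]
    [NormedSpace ℝ F] (f : E → F) (x : E) : Prop :=
  ∀ᶠ y in 𝓝 x, ContDiffAt ℝ ∞ f y

section SmoothNear

variable {E F G : Type*} [NormedAddCommGroup E] [NormedSpace ℝ E] [NormedAddCommGroup F]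
  [NormedSpace ℝ F] [NormedAddCommGroup G] [NormedSpace ℝ G] {f : E → F} {x : E}

theorem SmoothNear.contDiffAt (hf : SmoothNear f x) : ContDiffAt ℝ ∞ f x := hf.self_of_nhds

theorem SmoothNear.continuousAt (hf : SmoothNear f x) : ContinuousAt f x :=
  hf.contDiffAt.continuousAt

theorem SmoothNear.hasFDerivAt (hf : SmoothNear f x) : HasFDerivAt f (fderiv ℝ f x) x :=
  (hf.contDiffAt.differentiableAt (by simp)).hasFDerivAt

theorem ContDiff.smoothNear (hf : ContDiff ℝ ∞ f) : SmoothNear f x :=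
  Filter.Eventually.of_forall fun _ => hf.contDiffAt

theorem SmoothNear.eventually (hf : SmoothNear f x) : ∀ᶠ y in 𝓝 x, SmoothNear f y :=
  eventually_eventually_nhds.2 hf

theorem SmoothNear.congr {f' : E → F} (hf : SmoothNear f x) (h : f' =ᶠ[𝓝 x] f) :
    SmoothNear f' x := by
  filter_upwards [hf, eventually_eventually_nhds.2 h] with y hy h'
  exact hy.congr_of_eventuallyEq h'

theorem SmoothNear.comp {g : F → G} (hg : SmoothNear g (f x)) (hf : SmoothNear f x) :
    SmoothNear (fun y => g (f y)) x := by
  filter_upwards [hf, hf.continuousAt.eventually hg] with y hy h'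
  exact h'.comp y hy

theorem SmoothNear.prodMk {g : E → G} (hf : SmoothNear f x) (hg : SmoothNear g x) :
    SmoothNear (fun y => (f y, g y)) x := by
  filter_upwards [hf, hg] with y hy h'
  exact hy.prodMk h'

theorem SmoothNear.fderiv_apply (hf : SmoothNear f x) (v : E) :
    SmoothNear (fun y => fderiv ℝ f y v) x := by
  filter_upwards [hf] with y hy
  exact (hy.fderiv_right (m := ∞) (by simp)).clm_apply contDiffAt_const

theorem SmoothNear.sub {g : E → F} (hf : SmoothNear f x) (hg : SmoothNear g x) :
    SmoothNear (fun y => f y - g y) x := by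
  filter_upwards [hf, hg] with y hy h'
  exact hy.sub h'

theorem SmoothNear.add {g : E → F} (hf : SmoothNear f x) (hg : SmoothNear g x) :
    SmoothNear (fun y => f y + g y) x := by
  filter_upwards [hf, hg] with y hy h'
  exact hy.add h'

theorem SmoothNear.smul {g : E → ℝ} (hg : SmoothNear g x) (hf : SmoothNear f x) :
    SmoothNear (fun y => g y • f y) x := by
  filter_upwards [hf, hg] with y hy h'
  exact h'.smul hy

/-- A map that is smooth near `x` agrees near `x` with a compactly supported smooth map. -/
theorem SmoothNear.exists_contDiff_hasCompactSupport [FiniteDimensional ℝ E]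
    (hf : SmoothNear f x) :
    ∃ g : E → F, ContDiff ℝ ∞ g ∧ HasCompactSupport g ∧ g =ᶠ[𝓝 x] f := by
  obtain ⟨r, hr, hball⟩ := Metric.eventually_nhds_iff_ball.1 hf
  let b : ContDiffBump x := ⟨r / 4, r / 2, by positivity, by linarith⟩
  refine ⟨fun y => b y • f y, ?_, ?_, ?_⟩
  · refine contDiff_iff_contDiffAt.2 fun y => ?_
    by_cases hy : y ∈ Metric.ball x r
    · exact b.contDiff.contDiffAt.smul (hball y hy)
    · have : (fun y => b y • f y) =ᶠ[𝓝 y] fun _ => 0 := by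
        have hy' : y ∈ (Metric.closedBall x (r / 2))ᶜ := by
          simp only [Metric.mem_ball, not_lt, Set.mem_compl_iff, Metric.mem_closedBall,
            not_le] at hy ⊢
          linarith
        filter_upwards [Metric.isClosed_closedBall.isOpen_compl.mem_nhds hy'] with z hz
        have : b z = 0 := b.zero_of_le_dist (by
          simp only [Set.mem_compl_iff, Metric.mem_closedBall, not_le] at hz
          exact hz.le)
        simp [this]
      exact contDiffAt_const.congr_of_eventuallyEq this
  · exact b.hasCompactSupport.smul_right
  · filter_upwards [b.eventuallyEq_one] with y hy
    simp only [hy, Pi.one_apply, one_smul]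

end SmoothNear

theorem exists_bound_iteratedFDeriv_of_hasCompactSupport {E F : Type*} [NormedAddCommGroup E]
    [NormedSpace ℝ E] [NormedAddCommGroup F] [NormedSpace ℝ F] {f : E → F}
    (hf : HasCompactSupport f) (hf' : ContDiff ℝ ∞ f) (k : ℕ) :
    ∃ M, ∀ x, ‖iteratedFDeriv ℝ k f x‖ ≤ M := by
  obtain ⟨M, hM⟩ := (hf.iteratedFDeriv k).exists_bound_of_continuous
    (hf'.continuous_iteratedFDeriv (m := k) (by exact_mod_cast le_top))
  exact ⟨M, hM⟩

section Hadamard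

universe u
variable {Y H : Type u} [NormedAddCommGroup Y] [NormedSpace ℝ Y] [FiniteDimensional ℝ Y]
  [NormedAddCommGroup H] [NormedSpace ℝ H] [CompleteSpace H]

open MeasureTheory in
/-- Hadamard's lemma: a smooth function of `(t, y)` that vanishes for `t = 0` is divisible by `t`,
the quotient being `∫₀¹ ∂f/∂t (r t, y) dr`. -/
theorem SmoothNear.exists_eq_smul {f : ℝ × Y → H} {y₀ : Y} (hf : SmoothNear f (0, y₀))
    (h0 : ∀ᶠ y in 𝓝 y₀, f (0, y) = 0) :
    ∃ g : ℝ × Y → H, ContDiff ℝ ∞ g ∧ ∀ᶠ p in 𝓝 ((0 : ℝ), y₀), f p = p.1 • g p := by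
  obtain ⟨F, hF, hFc, hFf⟩ := hf.exists_contDiff_hasCompactSupport
  let D : ℝ × Y → H := fun p => fderiv ℝ F p (1, 0)
  have hD : ContDiff ℝ ∞ D := (hF.fderiv_right (m := ∞) (by simp)).clm_apply contDiff_const
  have hDc : HasCompactSupport D := by
    have h1 : HasCompactSupport fun p => fderiv ℝ F p := hFc.fderiv ℝ
    exact h1.comp_left (g := fun L : ℝ × Y →L[ℝ] H => L (1, 0)) rfl
  let T : ℝ → ℝ × Y →L[ℝ] ℝ × Y := fun r =>
    (r • ContinuousLinearMap.fst ℝ ℝ Y).prod (ContinuousLinearMap.snd ℝ ℝ Y)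
  let μ : Measure ℝ := volume.restrict (Set.Ioc 0 1)
  let g : ℝ × Y → H := fun p => ∫ r, D (T r p) ∂μ
  have hg : ContDiff ℝ ∞ g := by
    refine contDiff_integral_of_iteratedFDeriv_bound (q := fun p r => D (T r p)) ?_ fun k => ?_
    · refine hD.comp (f := fun x : (ℝ × Y) × ℝ => (x.2 • x.1.1, x.1.2)) ?_
      fun_prop
    · obtain ⟨M, hM⟩ := exists_bound_iteratedFDeriv_of_hasCompactSupport hDc hD k
      have hM0 : 0 ≤ M := (norm_nonneg _).trans (hM 0)
      refine ⟨fun _ => M, integrable_const _, ?_⟩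
      filter_upwards [ae_restrict_mem measurableSet_Ioc] with r hr p
      refine (norm_iteratedFDeriv_comp_clm_le hD (T r) k hM p).trans ?_
      have hT : ‖T r‖ ≤ 1 := by
        refine ContinuousLinearMap.opNorm_le_bound _ zero_le_one fun p => ?_
        simp only [T, ContinuousLinearMap.prod_apply, one_mul, Prod.norm_def]
        refine max_le_max ?_ le_rfl
        simp only [smul_apply, ContinuousLinearMap.coe_fst', norm_smul,
          Real.norm_eq_abs, abs_of_pos hr.1]
        exact mul_le_of_le_one_left (abs_nonneg _) hr.2
      exact mul_le_of_le_one_right hM0 (pow_le_one₀ (norm_nonneg _) hT)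
  refine ⟨g, hg, ?_⟩
  have h0' : ∀ᶠ p in 𝓝 ((0 : ℝ), y₀), F (0, p.2) = 0 := by
    have h1 : ∀ᶠ p in 𝓝 ((0 : ℝ), y₀), f (0, p.2) = 0 :=
      (continuous_snd.tendsto ((0 : ℝ), y₀)).eventually h0
    have h2 : ∀ᶠ p in 𝓝 ((0 : ℝ), y₀), F (0, p.2) = f (0, p.2) := by
      have : Filter.Tendsto (fun p : ℝ × Y => ((0 : ℝ), p.2)) (𝓝 ((0 : ℝ), y₀)) (𝓝 ((0 : ℝ), y₀)) :=
        Continuous.tendsto' (by fun_prop) _ _ rfl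
      exact this.eventually hFf
    filter_upwards [h1, h2] with p h1 h2
    rw [h2, h1]
  filter_upwards [hFf, h0'] with p hp hp0
  have hder : ∀ r : ℝ, HasDerivAt (fun r : ℝ => F (T r p)) (p.1 • D (T r p)) r := by
    intro r
    have h1 : HasDerivAt (fun r : ℝ => T r p) (p.1, 0) r := by
      have := (((hasDerivAt_id r).mul_const p.1).prodMk (hasDerivAt_const r p.2))
      simpa [T] using this
    have h2 := ((hF.differentiable (by simp) (T r p)).hasFDerivAt).comp_hasDerivAt r h1
    have h3 : ((p.1, 0) : ℝ × Y) = p.1 • (1, 0) := by simp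
    rw [h3, map_smul] at h2
    exact h2
  have hcont : Continuous fun r : ℝ => p.1 • D (T r p) :=
    (hD.continuous.comp (by fun_prop : Continuous fun r : ℝ => (r • p.1, p.2))).const_smul p.1
  have := intervalIntegral.integral_eq_sub_of_hasDerivAt (fun r _ => hder r)
    (hcont.intervalIntegrable 0 1)
  rw [intervalIntegral.integral_of_le zero_le_one, integral_smul] at this
  have e0 : T 0 p = (0, p.2) := by simp [T]
  have e1 : T 1 p = p := by simp [T]
  rw [e0, e1, hp0, sub_zero, hp] at this
  exact this.symm

end Hadamard

/-! ### The cosine as a function of the square -/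

/-- `f` is smooth on the whole space and each of its derivatives is bounded. -/
def BddDerivs {E F : Type*} [NormedAddCommGroup E] [NormedSpace ℝ E] [NormedAddCommGroup F]
    [NormedSpace ℝ F] (f : E → F) : Prop :=
  ContDiff ℝ ∞ f ∧ ∀ k : ℕ, ∃ M, ∀ x, ‖iteratedFDeriv ℝ k f x‖ ≤ M

/-- There is a smooth function `C` on the line with `C (x ^ 2) = cos x`. -/
theorem exists_contDiff_sq_eq_cos : ∃ C : ℝ → ℝ, ContDiff ℝ ∞ C ∧ ∀ x, C (x ^ 2) = Real.cos x := by
  let c : ℕ → ℝ := fun n => (-1) ^ n / (2 * n).factorial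
  have hc : ∀ n, c n ≠ 0 := fun n => by positivity
  have hr : (FormalMultilinearSeries.ofScalars ℝ c).radius = ⊤ := by
    refine FormalMultilinearSeries.ofScalars_radius_eq_top_of_tendsto ℝ c
      (Filter.Eventually.of_forall hc) ?_
    have h1 : ∀ n, ‖c n.succ‖ / ‖c n‖ ≤ 1 / ((n : ℝ) + 1) := by
      intro n
      have : (2 * n.succ).factorial = (2 * n + 2) * ((2 * n + 1) * (2 * n).factorial) := by
        rw [show 2 * n.succ = 2 * n + 1 + 1 by simp [Nat.succ_eq_add_one]; ring, Nat.factorial_succ,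
          Nat.factorial_succ]
      simp only [c, norm_div, norm_pow, norm_neg, norm_one, one_pow, Real.norm_natCast, this]
      have h : (0 : ℝ) < (2 * n).factorial := by positivity
      push_cast
      rw [div_div_eq_mul_div, div_mul_eq_mul_div, one_mul, div_one, div_le_div_iff₀ (by positivity)
        (by positivity)]
      have hn : (0 : ℝ) ≤ n := by positivity
      nlinarith [mul_nonneg hn h.le, mul_nonneg (mul_nonneg hn hn) h.le]
    exact squeeze_zero (fun n => by positivity) h1 tendsto_one_div_add_atTop_nhds_zero_nat
  have hs := (FormalMultilinearSeries.ofScalars ℝ c).hasFPowerSeriesOnBall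
    (by rw [hr]; exact ENNReal.zero_lt_top)
  rw [hr] at hs
  refine ⟨_, contDiff_iff_contDiffAt.2 fun x =>
    (hs.analyticAt_of_mem (y := x) (by simp)).contDiffAt, fun x => ?_⟩
  rw [FormalMultilinearSeries.sum]
  have := (Real.hasSum_cos x).tsum_eq
  rw [← this]
  refine tsum_congr fun n => ?_
  rw [FormalMultilinearSeries.ofScalars_apply_eq]
  simp only [c, smul_eq_mul, ← pow_mul]
  ring

/-- On `[1, ∞)` all derivatives of `s ↦ cos √s` are bounded: the differential equation that the
function satisfies expresses each derivative by the two preceding ones. -/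
theorem iteratedDeriv_bounded_of_sq_eq_cos {C : ℝ → ℝ} (hC : ContDiff ℝ ∞ C)
    (hcos : ∀ x, C (x ^ 2) = Real.cos x) (n : ℕ) :
    ∃ M, ∀ s, 1 ≤ s → |iteratedDeriv n C s| ≤ M := by
  have hd : ∀ n s, HasDerivAt (iteratedDeriv n C) (iteratedDeriv (n + 1) C s) s := by
    intro n s
    rw [iteratedDeriv_succ]
    exact (hC.differentiable_iteratedDeriv n (by exact_mod_cast WithTop.coe_lt_top _) s).hasDerivAt
  have h1 : ∀ x, 2 * x * iteratedDeriv 1 C (x ^ 2) = - Real.sin x := by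
    intro x
    have e1 := (hd 0 (x ^ 2)).comp x (hasDerivAt_pow 2 x)
    have e2 : iteratedDeriv 0 C ∘ (fun x : ℝ => x ^ 2) = Real.cos := by
      funext x; simp [hcos]
    rw [e2] at e1
    have := e1.unique (Real.hasDerivAt_cos x)
    rw [← this]; push_cast; ring
  have h2 : ∀ x, 4 * x ^ 2 * iteratedDeriv 2 C (x ^ 2) + 2 * iteratedDeriv 1 C (x ^ 2)
      + C (x ^ 2) = 0 := by
    intro x
    have e1 := ((hasDerivAt_id x).const_mul 2).mul ((hd 1 (x ^ 2)).comp x (hasDerivAt_pow 2 x))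
    have e2 : ((fun x : ℝ => 2 * id x) * (iteratedDeriv 1 C ∘ fun x : ℝ => x ^ 2))
        = fun x => - Real.sin x := by
      funext x; simp [← h1]
    rw [e2] at e1
    have := e1.unique (Real.hasDerivAt_sin x).neg
    rw [hcos]
    simp only [Function.comp, id] at this
    push_cast at this
    linarith
  -- the differential equation `4 s C'' + 2 C' + C = 0`, differentiated `n` times
  have ode : ∀ n s, 0 < s → 4 * s * iteratedDeriv (n + 2) C s
      + (4 * n + 2) * iteratedDeriv (n + 1) C s + iteratedDeriv n C s = 0 := by
    intro n
    induction n with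
    | zero =>
      intro s hs
      have := h2 (Real.sqrt s)
      rw [Real.sq_sqrt hs.le] at this
      simpa using this
    | succ n ih =>
      intro s hs
      have e1 := ((((hasDerivAt_id s).const_mul 4).mul (hd (n + 2) s)).add
        ((hd (n + 1) s).const_mul (4 * n + 2 : ℝ))).add (hd n s)
      have e2 := e1.congr_of_eventuallyEq (f₁ := fun _ => (0 : ℝ)) (by
        filter_upwards [lt_mem_nhds hs] with s hs
        exact (ih s hs).symm)
      have := e2.unique (hasDerivAt_const s (0 : ℝ))
      simp only [id] at this
      push_cast
      linarith
  have b0 : ∀ s, 1 ≤ s → |iteratedDeriv 0 C s| ≤ 1 := by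
    intro s hs
    have := hcos (Real.sqrt s)
    rw [Real.sq_sqrt (by linarith)] at this
    simpa [this] using Real.abs_cos_le_one _
  have b1 : ∀ s, 1 ≤ s → |iteratedDeriv 1 C s| ≤ 1 := by
    intro s hs
    have h := h1 (Real.sqrt s)
    have hs1 : 1 ≤ Real.sqrt s := Real.one_le_sqrt.2 hs
    rw [Real.sq_sqrt (by linarith)] at h
    have h3 := Real.abs_sin_le_one (Real.sqrt s)
    rw [← abs_neg, ← h, abs_mul, abs_of_pos (by linarith)] at h3
    nlinarith [abs_nonneg (iteratedDeriv 1 C s)]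
  suffices H : ∀ n, (∃ M, ∀ s, 1 ≤ s → |iteratedDeriv n C s| ≤ M) ∧
      (∃ M, ∀ s, 1 ≤ s → |iteratedDeriv (n + 1) C s| ≤ M) from (H n).1
  intro n
  induction n with
  | zero => exact ⟨⟨1, b0⟩, ⟨1, b1⟩⟩
  | succ n ih =>
    refine ⟨ih.2, ?_⟩
    obtain ⟨⟨M0, hM0⟩, ⟨M1, hM1⟩⟩ := ih
    refine ⟨(4 * n + 2) * M1 + M0, fun s hs => ?_⟩
    have e := ode n s (by linarith)
    have e' : 4 * s * iteratedDeriv (n + 2) C s =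
      -((4 * n + 2) * iteratedDeriv (n + 1) C s + iteratedDeriv n C s) := by linarith
    have h4 : |4 * s * iteratedDeriv (n + 2) C s| ≤ (4 * n + 2) * M1 + M0 := by
      rw [e', abs_neg]
      refine (abs_add_le _ _).trans (add_le_add ?_ (hM0 s hs))
      rw [abs_mul, abs_of_nonneg (by positivity)]
      exact mul_le_mul_of_nonneg_left (hM1 s hs) (by positivity)
    rw [abs_mul, abs_of_pos (by linarith)] at h4
    refine le_trans ?_ h4
    exact le_mul_of_one_le_left (abs_nonneg _) (by linarith)

/-- There is a function `C` on the line with bounded derivatives such that `C (x ^ 2) = cos x`. -/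
theorem exists_bddDerivs_sq_eq_cos : ∃ C : ℝ → ℝ, BddDerivs C ∧ ∀ x, C (x ^ 2) = Real.cos x := by
  obtain ⟨C, hC, hcos⟩ := exists_contDiff_sq_eq_cos
  -- `C` grows exponentially on the negative half-line, where it is cut off
  let χ : ℝ → ℝ := fun s => Real.smoothTransition (s + 2)
  have hχ : ContDiff ℝ ∞ χ := Real.smoothTransition.contDiff.comp (contDiff_id.add contDiff_const)
  have h1 : ∀ s, -1 ≤ s → χ s = 1 := fun s hs =>
    Real.smoothTransition.one_of_one_le (by linarith)
  have h0 : ∀ s, s ≤ -2 → χ s = 0 := fun s hs =>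
    Real.smoothTransition.zero_of_nonpos (by linarith)
  have hD : ContDiff ℝ ∞ (fun s => χ s * C s) := hχ.mul hC
  refine ⟨fun s => χ s * C s, ⟨hD, fun k => ?_⟩, fun x => ?_⟩
  · obtain ⟨M, hM⟩ := iteratedDeriv_bounded_of_sq_eq_cos hC hcos k
    obtain ⟨M', hM'⟩ := (isCompact_Icc (a := (-3 : ℝ)) (b := 1)).exists_bound_of_continuousOn
      (hD.continuous_iteratedFDeriv (m := k) (by exact_mod_cast le_top)).continuousOn
    refine ⟨max M M', fun s => ?_⟩
    rcases le_or_gt s 1 with hs | hs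
    · rcases le_or_gt (-3) s with hs' | hs'
      · exact (hM' s ⟨hs', hs⟩).trans (le_max_right _ _)
      · have : (fun s => χ s * C s) =ᶠ[𝓝 s] fun _ => 0 := by
          filter_upwards [gt_mem_nhds hs'] with t ht
          rw [h0 t (by linarith), zero_mul]
        have h3 := (this.iteratedFDeriv ℝ k).eq_of_nhds
        have h4 : iteratedFDeriv ℝ k (fun _ : ℝ => (0 : ℝ)) s = 0 := by
          have := iteratedFDeriv_fun_zero (𝕜 := ℝ) (E := ℝ) (F := ℝ) (n := k)
          exact congrFun this s
        rw [h3, h4, norm_zero]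
        refine le_trans (norm_nonneg _) ((hM' 0 (by norm_num)).trans (le_max_right _ _))
    · have : (fun s => χ s * C s) =ᶠ[𝓝 s] C := by
        filter_upwards [lt_mem_nhds hs] with t ht
        rw [h1 t (by linarith), one_mul]
      rw [(this.iteratedFDeriv ℝ k).eq_of_nhds, norm_iteratedFDeriv_eq_norm_iteratedDeriv]
      exact (hM s hs.le).trans (le_max_left _ _)
  · simp only [h1 (x ^ 2) (by nlinarith [sq_nonneg x]), one_mul, hcos]

theorem BddDerivs.deriv {C : ℝ → ℝ} (hC : BddDerivs C) : BddDerivs (deriv C) := by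
  refine ⟨hC.1.iterate_deriv 1, fun k => ?_⟩
  obtain ⟨M, hM⟩ := hC.2 (k + 1)
  refine ⟨M, fun x => ?_⟩
  have := hM x
  rw [norm_iteratedFDeriv_eq_norm_iteratedDeriv] at this ⊢
  rwa [← iteratedDeriv_succ']

theorem BddDerivs.mul {E : Type*} [NormedAddCommGroup E] [NormedSpace ℝ E] {f g : E → ℂ}
    (hf : BddDerivs f) (hg : BddDerivs g) : BddDerivs (fun x => f x * g x) := by
  refine ⟨hf.1.mul hg.1, fun k => ?_⟩
  choose M hM using hf.2
  choose N hN using hg.2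
  refine ⟨∑ i ∈ Finset.range (k + 1), (k.choose i : ℝ) * M i * N (k - i), fun x => ?_⟩
  refine (norm_iteratedFDeriv_mul_le hf.1 hg.1 x (by exact_mod_cast le_top)).trans ?_
  refine Finset.sum_le_sum fun i _ => ?_
  have := (norm_nonneg _).trans (hM i x)
  gcongr
  · exact hM i x
  · exact hN _ x

theorem BddDerivs.comp_clm {E F G : Type*} [NormedAddCommGroup E] [NormedSpace ℝ E]
    [NormedAddCommGroup F] [NormedSpace ℝ F] [NormedAddCommGroup G] [NormedSpace ℝ G] {f : F → G}
    (hf : BddDerivs f) (T : E →L[ℝ] F) : BddDerivs (fun x => f (T x)) := by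
  refine ⟨hf.1.comp T.contDiff, fun k => ?_⟩
  obtain ⟨M, hM⟩ := hf.2 k
  exact ⟨_, fun x => norm_iteratedFDeriv_comp_clm_le hf.1 T k hM x⟩

theorem BddDerivs.clm_comp {E F G : Type*} [NormedAddCommGroup E] [NormedSpace ℝ E]
    [NormedAddCommGroup F] [NormedSpace ℝ F] [NormedAddCommGroup G] [NormedSpace ℝ G] {f : E → F}
    (hf : BddDerivs f) (T : F →L[ℝ] G) : BddDerivs (fun x => T (f x)) := by
  refine ⟨T.contDiff.comp hf.1, fun k => ?_⟩
  obtain ⟨M, hM⟩ := hf.2 k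
  refine ⟨‖T‖ * M, fun x => ?_⟩
  exact (T.norm_iteratedFDeriv_comp_left hf.1.contDiffAt (by exact_mod_cast le_top)).trans
    (mul_le_mul_of_nonneg_left (hM x) (norm_nonneg _))

theorem bddDerivs_cexp_mul_I : BddDerivs (fun b : ℝ => Complex.exp (b * Complex.I)) := by
  refine ⟨(Complex.ofRealCLM.contDiff.mul contDiff_const).cexp, fun k => ⟨1, fun x => ?_⟩⟩
  have : iteratedDeriv k (fun b : ℝ => Complex.exp (b * Complex.I)) =
      fun b : ℝ => Complex.I ^ k * Complex.exp (b * Complex.I) := by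
    induction k with
    | zero => simp
    | succ k ih =>
      rw [iteratedDeriv_succ, ih]
      funext b
      have h1 : HasDerivAt (fun b : ℝ => (b : ℂ) * Complex.I) (1 * Complex.I) b :=
        (Complex.ofRealCLM.hasDerivAt (x := b)).mul_const Complex.I
      have := (h1.cexp.const_mul (Complex.I ^ k)).deriv
      rw [this]
      ring
  rw [norm_iteratedFDeriv_eq_norm_iteratedDeriv, this]
  simp [Complex.norm_exp_ofReal_mul_I]

/-! ### Whitney's theorem on even and odd functions -/

open MeasureTheory in
theorem integrable_mul_bddDerivs {P Q V : Type} [NormedAddCommGroup P] [NormedSpace ℝ P]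
    [NormedAddCommGroup Q] [NormedSpace ℝ Q] [NormedAddCommGroup V] [NormedSpace ℝ V]
    [MeasurableSpace V] [BorelSpace V] [SecondCountableTopology V] {μ : Measure V}
    {κ : Q → ℂ} (hκ : BddDerivs κ) {θ : V → ℂ} (hθ : ContDiff ℝ ∞ θ)
    (hint : ∀ k : ℕ, Integrable (fun w => ‖w‖ ^ k * ‖θ w‖) μ) {T : V → P →L[ℝ] Q}
    (hT : ContDiff ℝ ∞ fun x : P × V => T x.2 x.1) (p : P) :
    Integrable (fun w => θ w * κ (T w p)) μ := by
  obtain ⟨M, hM⟩ := hκ.2 0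
  have hcont : Continuous fun w => T w p :=
    hT.continuous.comp (by fun_prop : Continuous fun w : V => (p, w))
  refine ((hint 0).const_mul M).mono'
    (hθ.continuous.mul (hκ.1.continuous.comp hcont)).aestronglyMeasurable
    (Filter.Eventually.of_forall fun w => ?_)
  have := hM (T w p)
  rw [norm_iteratedFDeriv_zero] at this
  rw [norm_mul, pow_zero, one_mul, mul_comm]
  gcongr

open MeasureTheory in
/-- An integral `∫ θ w * κ (T w p) dw` is smooth in `p` if `θ` is rapidly decreasing, the derivatives
of `κ` are bounded and the linear map `T w` grows at most quadratically with `w`. -/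
theorem contDiff_integral_mul_bddDerivs {P Q V : Type} [NormedAddCommGroup P] [NormedSpace ℝ P]
    [NormedAddCommGroup Q] [NormedSpace ℝ Q] [NormedAddCommGroup V] [NormedSpace ℝ V]
    [MeasurableSpace V] [BorelSpace V] [SecondCountableTopology V] {μ : Measure V}
    {κ : Q → ℂ} (hκ : BddDerivs κ) {θ : V → ℂ} (hθ : ContDiff ℝ ∞ θ)
    (hint : ∀ k : ℕ, Integrable (fun w => ‖w‖ ^ k * ‖θ w‖) μ) {T : V → P →L[ℝ] Q}
    (hT : ContDiff ℝ ∞ fun x : P × V => T x.2 x.1) {c : ℝ} (hc : 0 ≤ c)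
    (hTc : ∀ w, ‖T w‖ ≤ c * (1 + ‖w‖ ^ 2)) :
    ContDiff ℝ ∞ fun p => ∫ w, θ w * κ (T w p) ∂μ := by
  refine contDiff_integral_of_iteratedFDeriv_bound (q := fun p w => θ w * κ (T w p)) ?_ fun k => ?_
  · exact (hθ.comp contDiff_snd).mul (hκ.1.comp hT)
  · obtain ⟨M, hM⟩ := hκ.2 k
    have hM0 : 0 ≤ M := (norm_nonneg _).trans (hM 0)
    refine ⟨fun w => (M * c ^ k * 2 ^ (k - 1)) *
      (‖w‖ ^ 0 * ‖θ w‖ + ‖w‖ ^ (2 * k) * ‖θ w‖), ((hint 0).add (hint (2 * k))).const_mul _,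
      Filter.Eventually.of_forall fun w p => ?_⟩
    have h1 : iteratedFDeriv ℝ k (fun p => θ w * κ (T w p)) p =
        θ w • iteratedFDeriv ℝ k (fun p => κ (T w p)) p := by
      have hs : ContDiffAt ℝ k (fun p => κ (T w p)) p :=
        (hκ.comp_clm (T w)).1.contDiffAt.of_le (by exact_mod_cast le_top)
      have := iteratedFDeriv_const_smul_apply (a := θ w) hs
      simpa [Pi.smul_def] using this
    rw [h1, norm_smul]
    have h2 := norm_iteratedFDeriv_comp_clm_le hκ.1 (T w) k hM p
    have h3 : ‖T w‖ ^ k ≤ c ^ k * (2 ^ (k - 1) * (1 + ‖w‖ ^ (2 * k))) := by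
      calc ‖T w‖ ^ k ≤ (c * (1 + ‖w‖ ^ 2)) ^ k := by gcongr; exact hTc w
        _ = c ^ k * (1 + ‖w‖ ^ 2) ^ k := mul_pow _ _ _
        _ ≤ c ^ k * (2 ^ (k - 1) * (1 ^ k + (‖w‖ ^ 2) ^ k)) := by
          gcongr
          exact add_pow_le zero_le_one (by positivity) k
        _ = _ := by rw [one_pow, pow_mul]
    calc ‖θ w‖ * ‖iteratedFDeriv ℝ k (fun p => κ (T w p)) p‖
        ≤ ‖θ w‖ * (M * (c ^ k * (2 ^ (k - 1) * (1 + ‖w‖ ^ (2 * k))))) := by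
          gcongr
          exact h2.trans (by gcongr)
      _ = _ := by ring

open FourierTransform RealInnerProductSpace in
/-- Whitney's theorem on differentiable even and odd functions, with parameters: near the origin, a
smooth function of `(t, y)` is the sum of an even part `A (t ^ 2, y)` and of an odd part
`t * B (t ^ 2, y)`, with `A` and `B` smooth on both sides of `0`. -/
theorem SmoothNear.exists_eq_even_add_odd {Y : Type} [NormedAddCommGroup Y] [NormedSpace ℝ Y]
    [FiniteDimensional ℝ Y] {f : ℝ × Y → ℝ} (hf : SmoothNear f 0) :
    ∃ A B : ℝ × Y → ℝ, ContDiff ℝ ∞ A ∧ ContDiff ℝ ∞ B ∧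
      ∀ᶠ p in 𝓝 (0 : ℝ × Y), f p = A (p.1 ^ 2, p.2) + p.1 * B (p.1 ^ 2, p.2) := by
  obtain ⟨F, hF, hFc, hFf⟩ := hf.exists_contDiff_hasCompactSupport
  obtain ⟨C, hC, hcos⟩ := exists_bddDerivs_sq_eq_cos
  have hsin : ∀ x, x * (-2 * deriv C (x ^ 2)) = Real.sin x := by
    intro x
    have e1 := ((hC.1.differentiable (by simp) (x ^ 2)).hasDerivAt).comp x (hasDerivAt_pow 2 x)
    have e2 : C ∘ (fun x : ℝ => x ^ 2) = Real.cos := by funext x; simp [hcos]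
    rw [e2] at e1
    have := e1.unique (Real.hasDerivAt_cos x)
    push_cast at this
    linarith
  let L : (ℝ × Y) ≃L[ℝ] EuclideanSpace ℝ (Fin (Module.finrank ℝ (ℝ × Y))) :=
    toEuclidean (E := ℝ × Y)
  set V := EuclideanSpace ℝ (Fin (Module.finrank ℝ (ℝ × Y)))
  let φ : V → ℂ := fun v => (F (L.symm v) : ℂ)
  have hφ : ContDiff ℝ ∞ φ := Complex.ofRealCLM.contDiff.comp (hF.comp L.symm.contDiff)
  have hφc : HasCompactSupport φ :=
    (hFc.comp_homeomorph L.symm.toHomeomorph).comp_left (g := ((↑) : ℝ → ℂ)) Complex.ofReal_zero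
  let Φ : SchwartzMap V ℂ := hφc.toSchwartzMap hφ
  let Ψ : SchwartzMap V ℂ := 𝓕 Φ
  have hinv : ∀ v, φ v = ∫ w, Complex.exp ((2 * Real.pi * ⟪w, v⟫ : ℝ) * Complex.I) * Ψ w := by
    intro v
    have h1 : 𝓕⁻ Ψ = Φ := FourierTransform.fourierInv_fourier_eq Φ
    have h2 : (𝓕⁻ (Ψ : V → ℂ)) v = φ v := by
      rw [← SchwartzMap.fourierInv_coe, h1]; rfl
    rw [← h2, Real.fourierInv_eq']
    simp only [smul_eq_mul]
  -- the frequency `ξ w` is dual to `t`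
  let e : V := L (1, 0)
  let ι : Y →L[ℝ] V := (L : (ℝ × Y) →L[ℝ] V).comp (ContinuousLinearMap.inr ℝ ℝ Y)
  let ξ : V → ℝ := fun w => 2 * Real.pi * ⟪w, e⟫
  have hL : ∀ p : ℝ × Y, L p = p.1 • e + ι p.2 := by
    intro p
    simp only [e, ι, ContinuousLinearMap.comp_apply, ContinuousLinearMap.inr_apply,
      ContinuousLinearEquiv.coe_coe, ← map_smul, ← map_add]
    simp
  let T : V → ℝ × Y →L[ℝ] ℝ × ℝ := fun w =>
    ((ξ w) ^ 2 • ContinuousLinearMap.fst ℝ ℝ Y).prod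
      ((2 * Real.pi) • ((innerSL ℝ w).comp (ι.comp (ContinuousLinearMap.snd ℝ ℝ Y))))
  have hξ : ContDiff ℝ ∞ ξ := contDiff_const.mul (contDiff_id.inner ℝ contDiff_const)
  have hT : ContDiff ℝ ∞ fun x : (ℝ × Y) × V => T x.2 x.1 := by
    refine ContDiff.prodMk (((hξ.comp contDiff_snd).pow 2).mul
      (contDiff_fst.comp contDiff_fst)) ?_
    exact contDiff_const.mul (ContDiff.inner ℝ contDiff_snd
      (ι.contDiff.comp (contDiff_snd.comp contDiff_fst)))
  have hξb : ∀ w, |ξ w| ≤ 2 * Real.pi * ‖e‖ * ‖w‖ := by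
    intro w
    have := abs_real_inner_le_norm w e
    simp only [ξ, abs_mul, abs_of_pos Real.two_pi_pos]
    nlinarith [Real.two_pi_pos]
  obtain ⟨c, hc, hTc⟩ : ∃ c : ℝ, 0 ≤ c ∧ ∀ w, ‖T w‖ ≤ c * (1 + ‖w‖ ^ 2) := by
    set c₁ := (2 * Real.pi * ‖e‖) ^ 2
    set c₂ := 2 * Real.pi * ‖ι‖
    have hc₁ : 0 ≤ c₁ := by positivity
    have hc₂ : 0 ≤ c₂ := by positivity
    refine ⟨c₁ + c₂, by positivity, fun w => ?_⟩
    refine ContinuousLinearMap.opNorm_le_bound _ (by positivity) fun p => ?_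
    have hp1 : |p.1| ≤ ‖p‖ := norm_fst_le p
    have hp2 : ‖p.2‖ ≤ ‖p‖ := norm_snd_le p
    change max |ξ w ^ 2 * p.1| |2 * Real.pi * ⟪w, ι p.2⟫| ≤ _
    refine max_le ?_ ?_
    · rw [abs_mul, abs_pow]
      calc |ξ w| ^ 2 * |p.1| ≤ (2 * Real.pi * ‖e‖ * ‖w‖) ^ 2 * ‖p‖ := by
            gcongr
            exact hξb w
        _ = c₁ * ‖w‖ ^ 2 * ‖p‖ := by ring
        _ ≤ (c₁ + c₂) * (1 + ‖w‖ ^ 2) * ‖p‖ := by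
            gcongr
            · linarith
            · linarith
    · rw [abs_mul, abs_of_pos Real.two_pi_pos]
      have h1 : |⟪w, ι p.2⟫| ≤ ‖w‖ * (‖ι‖ * ‖p‖) :=
        (abs_real_inner_le_norm _ _).trans (by
          gcongr
          exact (ι.le_opNorm _).trans (by gcongr))
      calc 2 * Real.pi * |⟪w, ι p.2⟫| ≤ 2 * Real.pi * (‖w‖ * (‖ι‖ * ‖p‖)) := by gcongr
        _ = c₂ * ‖w‖ * ‖p‖ := by ring
        _ ≤ (c₁ + c₂) * (1 + ‖w‖ ^ 2) * ‖p‖ := by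
            gcongr
            · linarith
            · nlinarith [sq_nonneg (‖w‖ - 1), norm_nonneg w]
  -- the kernels that replace `cos (t ξ)` and `sin (t ξ) / (t ξ)`, times the exponential in `y`
  let E : ℝ × ℝ → ℂ := fun x => Complex.exp (x.2 * Complex.I)
  have hE : BddDerivs E := bddDerivs_cexp_mul_I.comp_clm (ContinuousLinearMap.snd ℝ ℝ ℝ)
  let κ₁ : ℝ × ℝ → ℂ := fun x => (C x.1 : ℂ) * E x
  let κ₂ : ℝ × ℝ → ℂ := fun x => ((-2 * deriv C x.1 : ℝ) : ℂ) * E x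
  have hκ₁ : BddDerivs κ₁ :=
    ((hC.comp_clm (ContinuousLinearMap.fst ℝ ℝ ℝ)).clm_comp Complex.ofRealCLM).mul hE
  have hκ₂ : BddDerivs κ₂ :=
    (((hC.deriv.clm_comp ((-2 : ℝ) • ContinuousLinearMap.id ℝ ℝ)).comp_clm
      (ContinuousLinearMap.fst ℝ ℝ ℝ)).clm_comp Complex.ofRealCLM).mul hE
  let θ : V → ℂ := fun w => Ψ w * (ξ w * Complex.I)
  have hθ : ContDiff ℝ ∞ θ :=
    (Ψ.smooth ⊤).mul ((Complex.ofRealCLM.contDiff.comp hξ).mul contDiff_const)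
  have hΨint : ∀ k : ℕ, MeasureTheory.Integrable (fun w => ‖w‖ ^ k * ‖Ψ w‖) :=
    fun k => Ψ.integrable_pow_mul _ k
  have hθint : ∀ k : ℕ, MeasureTheory.Integrable (fun w => ‖w‖ ^ k * ‖θ w‖) := by
    intro k
    refine ((hΨint (k + 1)).const_mul (2 * Real.pi * ‖e‖)).mono'
      (((continuous_norm.pow k).mul hθ.continuous.norm).aestronglyMeasurable)
      (Filter.Eventually.of_forall fun w => ?_)
    rw [Real.norm_of_nonneg (by positivity)]
    simp only [θ, norm_mul, Complex.norm_real, Complex.norm_I, mul_one]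
    calc ‖w‖ ^ k * (‖Ψ w‖ * ‖ξ w‖) ≤ ‖w‖ ^ k * (‖Ψ w‖ * (2 * Real.pi * ‖e‖ * ‖w‖)) := by
          gcongr
          exact hξb w
      _ = _ := by ring
  have hA := contDiff_integral_mul_bddDerivs hκ₁ (Ψ.smooth ⊤) hΨint hT hc hTc
  have hB := contDiff_integral_mul_bddDerivs hκ₂ hθ hθint hT hc hTc
  refine ⟨_, _, Complex.reCLM.contDiff.comp hA, Complex.reCLM.contDiff.comp hB, ?_⟩
  have hint₁ := integrable_mul_bddDerivs hκ₁ (Ψ.smooth ⊤) hΨint hT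
  have hint₂ := integrable_mul_bddDerivs hκ₂ hθ hθint hT
  filter_upwards [hFf] with p hp
  have h1 : φ (L p) = (F p : ℂ) := by simp [φ]
  have h2 : φ (L p) = (∫ w, Ψ w * κ₁ (T w (p.1 ^ 2, p.2))) +
      p.1 * ∫ w, θ w * κ₂ (T w (p.1 ^ 2, p.2)) := by
    rw [hinv, ← MeasureTheory.integral_const_mul, ← MeasureTheory.integral_add
      (hint₁ _) ((hint₂ _).const_mul _)]
    refine MeasureTheory.integral_congr_ae (Filter.Eventually.of_forall fun w => ?_)
    have e1 : 2 * Real.pi * ⟪w, L p⟫ = p.1 * ξ w + 2 * Real.pi * ⟪w, ι p.2⟫ := by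
      rw [hL, inner_add_right, inner_smul_right]
      simp only [ξ]; ring
    have e0 : ξ w ^ 2 * p.1 ^ 2 = (p.1 * ξ w) ^ 2 := by ring
    have e2 : C (ξ w ^ 2 * p.1 ^ 2) = Real.cos (p.1 * ξ w) := by
      rw [← hcos, e0]
    have e3 : p.1 * ξ w * (-2 * deriv C (ξ w ^ 2 * p.1 ^ 2)) = Real.sin (p.1 * ξ w) := by
      rw [← hsin, e0]
    have e3' : (p.1 * ξ w * ((-2 * deriv C (ξ w ^ 2 * p.1 ^ 2) : ℝ) : ℂ) : ℂ)
        = Complex.sin ((p.1 * ξ w : ℝ) : ℂ) := by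
      rw [← Complex.ofReal_sin, ← e3]; push_cast; ring
    simp only [κ₁, κ₂, E, T, θ, ContinuousLinearMap.prod_apply, smul_apply,
      ContinuousLinearMap.coe_fst', ContinuousLinearMap.comp_apply, ContinuousLinearMap.coe_snd',
      innerSL_apply_apply, smul_eq_mul]
    rw [e1, e2, Complex.ofReal_add, add_mul, Complex.exp_add, Complex.exp_mul_I,
      Complex.ofReal_cos, ← e3']
    ring
  have h3 := congrArg Complex.re (h1.symm.trans h2)
  rw [Complex.ofReal_re, Complex.add_re, Complex.re_ofReal_mul] at h3
  rw [← hp, h3]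
  rfl

/-! ### Germs up to changes of coordinates -/

section Germs

variable {E F G E' F' E'' F'' : Type*}
  [NormedAddCommGroup E] [NormedSpace ℝ E] [NormedAddCommGroup F] [NormedSpace ℝ F]
  [NormedAddCommGroup G] [NormedSpace ℝ G]
  [NormedAddCommGroup E'] [NormedSpace ℝ E'] [NormedAddCommGroup F'] [NormedSpace ℝ F']
  [NormedAddCommGroup E''] [NormedSpace ℝ E''] [NormedAddCommGroup F''] [NormedSpace ℝ F'']

/-- `χ` is a local diffeomorphism at `x`. -/
def IsDiffeoGerm (χ : E → F) (x : E) : Prop :=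
  SmoothNear χ x ∧ (fderiv ℝ χ x).IsInvertible

theorem IsDiffeoGerm.comp {χ : E → F} {ψ : F → G} {x : E} (hψ : IsDiffeoGerm ψ (χ x))
    (hχ : IsDiffeoGerm χ x) : IsDiffeoGerm (fun y => ψ (χ y)) x := by
  refine ⟨hψ.1.comp hχ.1, ?_⟩
  have h : HasFDerivAt (fun y => ψ (χ y)) _ x := hψ.1.hasFDerivAt.comp x hχ.1.hasFDerivAt
  rw [h.fderiv]
  exact hψ.2.comp hχ.2

theorem isDiffeoGerm_id (x : E) : IsDiffeoGerm (fun y : E => y) x :=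
  ⟨contDiff_id.smoothNear, by
    rw [fderiv_fun_id]
    exact ContinuousLinearMap.isInvertible_equiv (f := .refl ℝ E)⟩

/-- Between spaces of the same finite dimension, an injective derivative suffices. -/
theorem IsDiffeoGerm.of_hasFDerivAt [FiniteDimensional ℝ E] [FiniteDimensional ℝ F]
    (hd : Module.finrank ℝ E = Module.finrank ℝ F) {χ : E → F} {x : E} {χ' : E →L[ℝ] F}
    (hχ : SmoothNear χ x) (h : HasFDerivAt χ χ' x) (hinj : ∀ v, χ' v = 0 → v = 0) :
    IsDiffeoGerm χ x := by
  refine ⟨hχ, ?_⟩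
  rw [h.fderiv]
  have hi : Function.Injective χ'.toLinearMap := (injective_iff_map_eq_zero _).2 hinj
  exact ⟨(LinearEquiv.ofInjectiveOfFinrankEq χ'.toLinearMap hi hd).toContinuousLinearEquiv, by
    ext v; rfl⟩

/-- The inverse function theorem, for a map that is smooth near `x`. -/
theorem IsDiffeoGerm.exists_openPartialHomeomorph [CompleteSpace E] {χ : E → F} {x : E}
    (hχ : IsDiffeoGerm χ x) : ∃ Φ : OpenPartialHomeomorph E F, ⇑Φ = χ ∧ x ∈ Φ.source ∧
      ∀ y ∈ Φ.source, ContDiffAt ℝ ∞ χ y ∧ (fderiv ℝ χ y).IsInvertible ∧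
        ContDiffAt ℝ ∞ Φ.symm (χ y) := by
  obtain ⟨hs, χ', hχ'⟩ := hχ
  have hd : HasFDerivAt χ (χ' : E →L[ℝ] F) x := hχ' ▸ hs.hasFDerivAt
  let Φ := hs.contDiffAt.toOpenPartialHomeomorph χ hd (by simp)
  have hinv : ∀ᶠ y in 𝓝 x, (fderiv ℝ χ y).IsInvertible := by
    have hc : ContinuousAt (fderiv ℝ χ) x :=
      (hs.contDiffAt.fderiv_right (m := 0) (by simp)).continuousAt
    have := ContinuousLinearEquiv.nhds χ'
    rw [hχ'] at this
    filter_upwards [hc.eventually this] with y ⟨L, hL⟩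
    exact ⟨L, hL⟩
  obtain ⟨U, hU, hUo, hxU⟩ := eventually_nhds_iff.1 (hs.and hinv)
  have hx : x ∈ Φ.source := hs.contDiffAt.mem_toOpenPartialHomeomorph_source hd (by simp)
  refine ⟨Φ.restrOpen U hUo, rfl, ⟨hx, hxU⟩, fun y hy => ?_⟩
  obtain ⟨hy1, hy2⟩ := hU y hy.2
  refine ⟨hy1, hy2, ?_⟩
  obtain ⟨L, hL⟩ := hy2
  have hmem : χ y ∈ (Φ.restrOpen U hUo).target := (Φ.restrOpen U hUo).map_source hy
  have hleft : (Φ.restrOpen U hUo).symm (χ y) = y := (Φ.restrOpen U hUo).left_inv hy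
  refine OpenPartialHomeomorph.contDiffAt_symm (f₀' := L) _ hmem ?_ ?_
  · rw [hleft, hL]
    exact (hy1.differentiableAt (by simp)).hasFDerivAt
  · rw [hleft]
    exact hy1

theorem IsDiffeoGerm.exists_inverse [CompleteSpace E] {χ : E → F} {x : E}
    (hχ : IsDiffeoGerm χ x) : ∃ σ : F → E, IsDiffeoGerm σ (χ x) ∧ σ (χ x) = x ∧
      (∀ᶠ y in 𝓝 x, σ (χ y) = y) ∧ ∀ᶠ z in 𝓝 (χ x), χ (σ z) = z := by
  obtain ⟨Φ, rfl, hx, hΦ⟩ := hχ.exists_openPartialHomeomorph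
  have hσ : SmoothNear Φ.symm (Φ x) := by
    filter_upwards [Φ.open_target.mem_nhds (Φ.map_source hx)] with z hz
    have := (hΦ _ (Φ.map_target hz)).2.2
    rwa [Φ.right_inv hz] at this
  have hl : ∀ᶠ y in 𝓝 x, Φ.symm (Φ y) = y := Φ.eventually_left_inverse hx
  have hr : ∀ᶠ z in 𝓝 (Φ x), Φ (Φ.symm z) = z := Φ.eventually_right_inverse (Φ.map_source hx)
  refine ⟨Φ.symm, ⟨hσ, ?_⟩, Φ.left_inv hx, hl, hr⟩
  have h1 := hχ.1.hasFDerivAt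
  have h2 := hσ.hasFDerivAt
  have e1 : (fderiv ℝ Φ.symm (Φ x)).comp (fderiv ℝ Φ x) = .id ℝ E :=
    ((h2.comp x h1).congr_of_eventuallyEq (hl.mono fun y hy => hy.symm)).unique (hasFDerivAt_id x)
  have e2 : (fderiv ℝ Φ x).comp (fderiv ℝ Φ.symm (Φ x)) = .id ℝ F := by
    have h1' : HasFDerivAt Φ (fderiv ℝ Φ x) (Φ.symm (Φ x)) := by rwa [Φ.left_inv hx]
    exact ((h1'.comp (Φ x) h2).congr_of_eventuallyEq (hr.mono fun y hy => hy.symm)).unique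
      (hasFDerivAt_id _)
  exact ContinuousLinearMap.IsInvertible.of_inverse e1 e2

/-- The germs of `g` at `x` and of `g'` at `x'` differ by smooth changes of coordinates `χ` in the
source and `ψ` in the target. -/
def GermEquiv (g : E → F) (x : E) (g' : E' → F') (x' : E') : Prop :=
  ∃ (χ : E → E') (ψ : F → F'), IsDiffeoGerm χ x ∧ χ x = x' ∧ IsDiffeoGerm ψ (g x) ∧
    ∀ᶠ y in 𝓝 x, ψ (g y) = g' (χ y)

theorem GermEquiv.trans {g : E → F} {x : E} {g' : E' → F'} {x' : E'} {g'' : E'' → F''} {x'' : E''}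
    (h : GermEquiv g x g' x') (h' : GermEquiv g' x' g'' x'') : GermEquiv g x g'' x'' := by
  obtain ⟨χ, ψ, hχ, rfl, hψ, he⟩ := h
  obtain ⟨χ', ψ', hχ', rfl, hψ', he'⟩ := h'
  refine ⟨fun y => χ' (χ y), fun z => ψ' (ψ z), hχ'.comp hχ, rfl, ?_, ?_⟩
  · refine IsDiffeoGerm.comp ?_ hψ
    rwa [he.self_of_nhds]
  · filter_upwards [he, hχ.1.continuousAt.eventually he'] with y h1 h2
    rw [h1, h2]

theorem GermEquiv.symm [CompleteSpace E] [CompleteSpace F] {g : E → F} {x : E} {g' : E' → F'}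
    {x' : E'} (h : GermEquiv g x g' x') (hg : ContinuousAt g x) : GermEquiv g' x' g x := by
  obtain ⟨χ, ψ, hχ, rfl, hψ, he⟩ := h
  obtain ⟨σ, hσ, hσx, -, hσr⟩ := hχ.exists_inverse
  obtain ⟨κ, hκ, -, hκl, -⟩ := hψ.exists_inverse
  refine ⟨σ, κ, hσ, hσx, ?_, ?_⟩
  · rwa [← he.self_of_nhds]
  · have hc : Filter.Tendsto σ (𝓝 (χ x)) (𝓝 x) := by
      have := hσ.1.continuousAt.tendsto
      rwa [hσx] at this
    filter_upwards [hσr, hc.eventually he, hc.eventually (hg.eventually hκl)] with z h1 h2 h3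
    rw [← h3, h2, h1]

/-- A change of coordinates in the source. -/
theorem GermEquiv.of_comp [CompleteSpace E'] {g : E → F} {x' : E'} {σ : E' → E}
    (hσ : IsDiffeoGerm σ x') : GermEquiv g (σ x') (fun y => g (σ y)) x' := by
  obtain ⟨χ, hχ, hχx, -, hr⟩ := hσ.exists_inverse
  refine ⟨χ, fun z => z, hχ, hχx, isDiffeoGerm_id _, ?_⟩
  filter_upwards [hr] with y hy
  rw [hy]

/-- The second intrinsic derivative of `g` at `x` is non-degenerate: `dg(x)` has a kernel, and for
`v ≠ 0` in this kernel the map `u ↦ d²g(x)(u, v)` into the cokernel of `dg(x)` is injective.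
This is the condition that characterises cross-caps. -/
def IsNondegenerateAt (g : E → F) (x : E) : Prop :=
  (∃ v, v ≠ 0 ∧ fderiv ℝ g x v = 0) ∧ ∀ v, v ≠ 0 → fderiv ℝ g x v = 0 →
    ∀ u, fderiv ℝ (fun y => fderiv ℝ g y v) x u ∈ LinearMap.range (fderiv ℝ g x).toLinearMap →
      u = 0

theorem hasFDerivAt_fderiv_apply {g : E → F} {x : E} (hg : SmoothNear g x) (v : E) :
    HasFDerivAt (fun y => fderiv ℝ g y v) ((fderiv ℝ (fderiv ℝ g) x).flip v) x := by
  have h : DifferentiableAt ℝ (fderiv ℝ g) x :=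
    (hg.contDiffAt.fderiv_right (m := ∞) (by simp)).differentiableAt (by simp)
  have := h.hasFDerivAt.clm_apply (hasFDerivAt_const v x)
  convert this using 1
  ext u
  simp

theorem fderiv_fderiv_apply {g : E → F} {x : E} (hg : SmoothNear g x) (v u : E) :
    fderiv ℝ (fun y => fderiv ℝ g y v) x u = fderiv ℝ (fderiv ℝ g) x u v := by
  rw [(hasFDerivAt_fderiv_apply hg v).fderiv]; rfl

/-- The second derivative of a composite `k ∘ g`. -/
theorem fderiv_fderiv_comp {g : E → F} {k : F → G} {x : E} (hg : SmoothNear g x)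
    (hk : SmoothNear k (g x)) (v u : E) :
    fderiv ℝ (fun y => fderiv ℝ (fun y => k (g y)) y v) x u =
      fderiv ℝ (fun z => fderiv ℝ k z (fderiv ℝ g x v)) (g x) (fderiv ℝ g x u) +
        fderiv ℝ k (g x) (fderiv ℝ (fun y => fderiv ℝ g y v) x u) := by
  have h1 : (fun y => fderiv ℝ (fun y => k (g y)) y v) =ᶠ[𝓝 x]
      fun y => (fderiv ℝ k (g y)) (fderiv ℝ g y v) := by
    filter_upwards [hg.eventually, hg.continuousAt.eventually hk.eventually] with y h1 h2
    have h3 : HasFDerivAt (fun y => k (g y)) _ y := h2.hasFDerivAt.comp y h1.hasFDerivAt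
    rw [h3.fderiv]
    rfl
  have h2 : HasFDerivAt (fderiv ℝ k) (fderiv ℝ (fderiv ℝ k) (g x)) (g x) :=
    ((hk.contDiffAt.fderiv_right (m := ∞) (by simp)).differentiableAt (by simp)).hasFDerivAt
  have h3 : HasFDerivAt (fun y => (fderiv ℝ k (g y)) (fderiv ℝ g y v)) _ x :=
    (h2.comp x hg.hasFDerivAt).clm_apply (hasFDerivAt_fderiv_apply hg v)
  rw [h1.fderiv_eq, fderiv_fderiv_apply hk, fderiv_fderiv_apply hg]
  rw [h3.fderiv]
  simp [add_comm]

/-- Under an equivalence `ψ ∘ g = g' ∘ χ`, first derivatives correspond to each other, and so do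
second derivatives along the kernel, modulo the image of the first derivative. -/
theorem fderiv_fderiv_of_eventuallyEq_comp {g : E → F} {x : E} {g' : E' → F'} {χ : E → E'}
    {ψ : F → F'} (hg : SmoothNear g x) (hg' : SmoothNear g' (χ x)) (hχ : SmoothNear χ x)
    (hψ : SmoothNear ψ (g x)) (he : ∀ᶠ y in 𝓝 x, ψ (g y) = g' (χ y)) :
    (∀ v, fderiv ℝ ψ (g x) (fderiv ℝ g x v) = fderiv ℝ g' (χ x) (fderiv ℝ χ x v)) ∧
    ∀ v, fderiv ℝ g x v = 0 → ∀ u, ∃ w,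
      fderiv ℝ ψ (g x) (fderiv ℝ (fun y => fderiv ℝ g y v) x u) =
      fderiv ℝ (fun z => fderiv ℝ g' z (fderiv ℝ χ x v)) (χ x) (fderiv ℝ χ x u) +
        fderiv ℝ g' (χ x) w := by
  have he' : (fun y => ψ (g y)) =ᶠ[𝓝 x] fun y => g' (χ y) := he
  constructor
  · intro v
    have h1 : HasFDerivAt (fun y => ψ (g y)) _ x := hψ.hasFDerivAt.comp x hg.hasFDerivAt
    have h2 : HasFDerivAt (fun y => g' (χ y)) _ x := hg'.hasFDerivAt.comp x hχ.hasFDerivAt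
    have := (h1.congr_of_eventuallyEq he'.symm).unique h2
    exact DFunLike.congr_fun this v
  · intro v hv u
    refine ⟨fderiv ℝ (fun y => fderiv ℝ χ y v) x u, ?_⟩
    rw [← fderiv_fderiv_comp hχ hg' v u]
    have h1 := fderiv_fderiv_comp hg hψ v u
    rw [hv] at h1
    simp only [map_zero, fderiv_fun_const, Pi.zero_apply, zero_apply, zero_add] at h1
    rw [← h1]
    have : (fun y => fderiv ℝ (fun y => ψ (g y)) y v) =ᶠ[𝓝 x]
        fun y => fderiv ℝ (fun y => g' (χ y)) y v := by
      filter_upwards [eventually_eventually_nhds.2 he'] with y hy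
      rw [Filter.EventuallyEq.fderiv_eq hy]
    rw [this.fderiv_eq]

theorem IsNondegenerateAt.of_germEquiv {g : E → F} {x : E} {g' : E' → F'} {x' : E'}
    (h : IsNondegenerateAt g x) (hg : SmoothNear g x) (hg' : SmoothNear g' x')
    (he : GermEquiv g x g' x') : IsNondegenerateAt g' x' := by
  obtain ⟨χ, ψ, hχ, rfl, hψ, he⟩ := he
  obtain ⟨h1, h2⟩ := fderiv_fderiv_of_eventuallyEq_comp hg hg' hχ.1 hψ.1 he
  obtain ⟨⟨v, hv, hv0⟩, h⟩ := h
  constructor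
  · refine ⟨fderiv ℝ χ x v, fun h0 => hv (hχ.2.injective ?_), ?_⟩
    · rw [h0, map_zero]
    · rw [← h1, hv0, map_zero]
  · intro v' hv' hv0' u' hu'
    obtain ⟨v, rfl⟩ := hχ.2.surjective v'
    obtain ⟨u, rfl⟩ := hχ.2.surjective u'
    have hv0 : fderiv ℝ g x v = 0 := hψ.2.injective (by rw [h1, hv0', map_zero])
    have hv : v ≠ 0 := fun h0 => hv' (by rw [h0, map_zero])
    obtain ⟨w, hw⟩ := h2 v hv0 u
    obtain ⟨a, ha⟩ := hu'
    obtain ⟨b, hb⟩ := hχ.2.surjective (a + w)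
    have : u = 0 := by
      refine h v hv hv0 u ⟨b, hψ.2.injective ?_⟩
      change fderiv ℝ ψ (g x) (fderiv ℝ g x b) = _
      rw [h1, hb, hw, map_add, ← ha]
      rfl
    rw [this, map_zero]

end Germs

/-! ### Corank one maps as graphs -/

section NormalForm

variable {E F : Type*} [NormedAddCommGroup E] [NormedSpace ℝ E] [NormedAddCommGroup F]
  [NormedSpace ℝ F] [FiniteDimensional ℝ E] [FiniteDimensional ℝ F]
  {Y : Type} [NormedAddCommGroup Y] [NormedSpace ℝ Y] [FiniteDimensional ℝ Y]

/-- Linear coordinates on `F` in which the subspace `R` is the first factor and a given vector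
outside of `R` has the component `(1, 0)` in the second factor. -/
theorem exists_continuousLinearEquiv_prod_of_notMem (R : Submodule ℝ F)
    (hR : Module.finrank ℝ R = Module.finrank ℝ Y)
    (hF : Module.finrank ℝ F = 2 * Module.finrank ℝ Y + 1) {w : F} (hw : w ∉ R) :
    ∃ L : F ≃L[ℝ] Y × (ℝ × Y), (∀ z, z ∈ R ↔ (L z).2 = 0) ∧ (L w).2 = (1, 0) := by
  obtain ⟨S, hS⟩ := R.exists_isCompl
  have hSd : Module.finrank ℝ S = Module.finrank ℝ (ℝ × Y) := by
    have := Submodule.finrank_add_eq_of_isCompl hS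
    rw [Module.finrank_prod, Module.finrank_self]
    omega
  let eR : R ≃ₗ[ℝ] Y := LinearEquiv.ofFinrankEq _ _ hR
  let eS : S ≃ₗ[ℝ] ℝ × Y := LinearEquiv.ofFinrankEq _ _ hSd
  let d := R.prodEquivOfIsCompl S hS
  let M : F ≃ₗ[ℝ] Y × (ℝ × Y) := d.symm.trans (eR.prodCongr eS)
  have hM : ∀ z, z ∈ R ↔ (M z).2 = 0 := by
    intro z
    simp only [M, LinearEquiv.trans_apply, LinearEquiv.prodCongr_apply, LinearEquiv.map_eq_zero_iff]
    exact (Submodule.prodEquivOfIsCompl_symm_apply_snd_eq_zero R S hS).symm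
  have hMw : (M w).2 ≠ 0 := fun h => hw ((hM w).2 h)
  obtain ⟨A, hA⟩ := SeparatingDual.exists_continuousLinearEquiv_apply_eq (R := ℝ) (V := ℝ × Y)
    hMw (y := (1, 0)) (by simp)
  refine ⟨(M.trans ((LinearEquiv.refl ℝ Y).prodCongr A.toLinearEquiv)).toContinuousLinearEquiv,
    fun z => ?_, ?_⟩
  · rw [hM]
    simp
  · simpa using hA

theorem fderiv_snd_prodMk {Y : Type*} [NormedAddCommGroup Y] [NormedSpace ℝ Y]
    {c : ℝ × Y → ℝ × Y} {p : ℝ × Y} (hc : SmoothNear c p) (v : ℝ × Y) :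
    fderiv ℝ (fun p : ℝ × Y => (p.2, c p)) p v = (v.2, fderiv ℝ c p v) := by
  have : HasFDerivAt (fun p : ℝ × Y => (p.2, c p)) _ p :=
    (ContinuousLinearMap.snd ℝ ℝ Y).hasFDerivAt.prodMk hc.hasFDerivAt
  rw [this.fderiv]
  rfl

/-- A map of corank one is, in suitable coordinates, the graph of a map whose derivative vanishes
at the origin, and with `∂²c/∂t² = (1, 0)` there. -/
theorem exists_germEquiv_graph {g : E → F} {x : E} (hg : SmoothNear g x)
    (hnd : IsNondegenerateAt g x) (hE : Module.finrank ℝ E = Module.finrank ℝ Y + 1)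
    (hF : Module.finrank ℝ F = 2 * Module.finrank ℝ Y + 1)
    (hr : Module.finrank ℝ (LinearMap.range (fderiv ℝ g x).toLinearMap) = Module.finrank ℝ Y) :
    ∃ c : ℝ × Y → ℝ × Y, SmoothNear c 0 ∧ fderiv ℝ c 0 = 0 ∧
      fderiv ℝ (fun p => fderiv ℝ c p (1, 0)) 0 (1, 0) = (1, 0) ∧
      GermEquiv g x (fun p : ℝ × Y => (p.2, c p)) 0 := by
  obtain ⟨⟨v, hv, hv0⟩, hnd⟩ := hnd
  have hw := mt (hnd v hv hv0 v) hv
  set w := fderiv ℝ (fun y => fderiv ℝ g y v) x v with hwdef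
  obtain ⟨L, hL, hLw⟩ := exists_continuousLinearEquiv_prod_of_notMem (Y := Y) _ hr hF hw
  obtain ⟨l, hl⟩ := SeparatingDual.exists_eq_one (R := ℝ) hv
  have hdim : Module.finrank ℝ E = Module.finrank ℝ (ℝ × Y) := by
    rw [hE, Module.finrank_prod, Module.finrank_self, add_comm]
  -- the new variables: `t` is linear and equals `1` on `v`, and `y` is the component of `g` along the
  -- image of its derivative
  have hker : ∀ u, fderiv ℝ g x u = 0 → ∃ a : ℝ, u = a • v := by
    have h1 := LinearMap.finrank_range_add_finrank_ker (fderiv ℝ g x).toLinearMap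
    have h2 : Module.finrank ℝ (LinearMap.ker (fderiv ℝ g x).toLinearMap) = 1 := by omega
    intro u hu
    have h3 := (finrank_eq_one_iff_of_nonzero' (⟨v, hv0⟩ : LinearMap.ker (fderiv ℝ g x).toLinearMap)
      (by simpa [Subtype.ext_iff] using hv)).1 h2 ⟨u, hu⟩
    obtain ⟨a, ha⟩ := h3
    exact ⟨a, by simpa [Subtype.ext_iff] using ha.symm⟩
  let ψ : F → Y × (ℝ × Y) := fun z => L (z - g x)
  have hψd : ∀ z, HasFDerivAt ψ (L : F →L[ℝ] Y × (ℝ × Y)) z := fun z =>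
    (L : F →L[ℝ] Y × (ℝ × Y)).hasFDerivAt.comp z ((hasFDerivAt_id z).sub_const (g x))
  have hψs : ContDiff ℝ ∞ ψ := L.contDiff.comp (contDiff_id.sub contDiff_const)
  have hψ : IsDiffeoGerm ψ (g x) :=
    ⟨hψs.smoothNear, by rw [(hψd _).fderiv]; exact ContinuousLinearMap.isInvertible_equiv⟩
  let χ : E → ℝ × Y := fun y => (l (y - x), (ψ (g y)).1)
  have hψg : HasFDerivAt (fun y => ψ (g y)) ((L : F →L[ℝ] Y × (ℝ × Y)).comp (fderiv ℝ g x)) x :=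
    (hψd _).comp x hg.hasFDerivAt
  have hχd : HasFDerivAt χ (l.prod ((ContinuousLinearMap.fst ℝ Y (ℝ × Y)).comp
      ((L : F →L[ℝ] Y × (ℝ × Y)).comp (fderiv ℝ g x)))) x :=
    (l.hasFDerivAt.comp x ((hasFDerivAt_id x).sub_const x)).prodMk
      ((ContinuousLinearMap.fst ℝ Y (ℝ × Y)).hasFDerivAt.comp x hψg)
  have hLr : ∀ u, (L (fderiv ℝ g x u)).2 = 0 := fun u => (hL _).1 ⟨u, rfl⟩
  have hχs : SmoothNear χ x :=
    (l.contDiff.comp (contDiff_id.sub contDiff_const)).smoothNear.prodMk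
      ((contDiff_fst (n := ∞)).smoothNear.comp (hψs.smoothNear.comp hg))
  have hχ : IsDiffeoGerm χ x := by
    refine IsDiffeoGerm.of_hasFDerivAt hdim hχs hχd fun u hu => ?_
    simp only [ContinuousLinearMap.prod_apply, Prod.mk_eq_zero] at hu
    have h0 : fderiv ℝ g x u = 0 := by
      have : L (fderiv ℝ g x u) = 0 := Prod.ext hu.2 (hLr u)
      simpa using this
    obtain ⟨a, rfl⟩ := hker u h0
    have : a = 0 := by simpa [hl] using hu.1
    simp [this]
  have hχ0 : χ x = 0 := by simp [χ, ψ]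
  obtain ⟨σ, hσ, hσx, hσl, -⟩ := hχ.exists_inverse
  rw [hχ0] at hσ hσx
  let c : ℝ × Y → ℝ × Y := fun p => (ψ (g (σ p))).2
  have hgσ : SmoothNear (fun p => g (σ p)) 0 := SmoothNear.comp (by rwa [hσx]) hσ.1
  have hc : SmoothNear c 0 := (contDiff_snd (n := ∞)).smoothNear.comp (hψs.smoothNear.comp hgσ)
  have heq : ∀ᶠ y in 𝓝 x, ψ (g y) = ((χ y).2, c (χ y)) := by
    filter_upwards [hσl] with y hy
    simp only [c, hy]
    rfl
  have hc' : fderiv ℝ c 0 = 0 := by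
    have h1 : HasFDerivAt g (fderiv ℝ g x) (σ 0) := by rw [hσx]; exact hg.hasFDerivAt
    have h2 : HasFDerivAt (fun p => (ψ (g (σ p))).2) _ 0 :=
      (ContinuousLinearMap.snd ℝ Y (ℝ × Y)).hasFDerivAt.comp 0
        ((hψd _).comp 0 (h1.comp 0 hσ.1.hasFDerivAt))
    rw [h2.fderiv]
    exact ContinuousLinearMap.ext fun u => hLr _
  have hg' : SmoothNear (fun p : ℝ × Y => (p.2, c p)) 0 :=
    (contDiff_snd (n := ∞)).smoothNear.prodMk hc
  refine ⟨c, hc, hc', ?_, χ, ψ, hχ, hχ0, hψ, heq⟩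
  · have key := fderiv_fderiv_of_eventuallyEq_comp hg (g' := fun p : ℝ × Y => (p.2, c p))
      (by rw [hχ0]; exact hg') hχs hψ.1 heq
    obtain ⟨b, hb⟩ := key.2 v hv0 v
    have hχv : fderiv ℝ χ x v = (1, 0) := by
      rw [hχd.fderiv]
      simp [hl, hv0]
    rw [hχv, hχ0, (hψd _).fderiv, fderiv_snd_prodMk hc, hc'] at hb
    have h3 : (fun z => fderiv ℝ (fun p : ℝ × Y => (p.2, c p)) z (1, 0)) =ᶠ[𝓝 0]
        fun z => ((0 : Y), fderiv ℝ c z (1, 0)) := by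
      filter_upwards [hc.eventually] with z hz
      rw [fderiv_snd_prodMk hz]
    have h4 : HasFDerivAt (fun z => ((0 : Y), fderiv ℝ c z (1, 0))) _ 0 :=
      (hasFDerivAt_const (0 : Y) 0).prodMk (hc.fderiv_apply (1, 0)).hasFDerivAt
    rw [h3.fderiv_eq, h4.fderiv] at hb
    have h5 := congrArg Prod.snd hb
    simp only [ContinuousLinearMap.prod_apply, Prod.snd_add, zero_apply, add_zero] at h5
    rw [← h5]
    exact hLw

end NormalForm

/-! ### The Morse lemma with parameters -/

section Morse

variable {Y : Type} [NormedAddCommGroup Y] [NormedSpace ℝ Y] [FiniteDimensional ℝ Y]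

theorem SmoothNear.hasDerivAt_slice {Y H : Type*} [NormedAddCommGroup Y] [NormedSpace ℝ Y]
    [NormedAddCommGroup H] [NormedSpace ℝ H]
    {a : ℝ × Y → H} {t : ℝ} {y : Y} (ha : SmoothNear a (t, y)) :
    HasDerivAt (fun r => a (r, y)) (fderiv ℝ a (t, y) (1, 0)) t :=
  ha.hasFDerivAt.comp_hasDerivAt t ((hasDerivAt_id t).prodMk (hasDerivAt_const t y))

/-- The critical points of `t ↦ a (t, y)` near a non-degenerate one form a smooth graph. -/
theorem exists_smoothNear_critical {a : ℝ × Y → ℝ} (ha : SmoothNear a 0)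
    (ha1 : fderiv ℝ a 0 (1, 0) = 0) (ha2 : fderiv ℝ (fun p => fderiv ℝ a p (1, 0)) 0 (1, 0) ≠ 0) :
    ∃ τ : Y → ℝ, SmoothNear τ 0 ∧ τ 0 = 0 ∧ ∀ᶠ y in 𝓝 (0 : Y), fderiv ℝ a (τ y, y) (1, 0) = 0 := by
  -- straighten the equation `∂a/∂t = 0`
  let ζ : ℝ × Y → ℝ × Y := fun p => (fderiv ℝ a p (1, 0), p.2)
  have h1 := ha.fderiv_apply (1, 0)
  have hζs : SmoothNear ζ 0 := h1.prodMk (contDiff_snd (n := ∞)).smoothNear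
  have hζd := h1.hasFDerivAt.prodMk (ContinuousLinearMap.snd ℝ ℝ Y).hasFDerivAt
  have hζ : IsDiffeoGerm ζ 0 := by
    refine IsDiffeoGerm.of_hasFDerivAt rfl hζs hζd fun u hu => ?_
    obtain ⟨t, y⟩ := u
    simp only [ContinuousLinearMap.prod_apply, ContinuousLinearMap.coe_snd',
      Prod.mk_eq_zero] at hu
    obtain ⟨hu1, rfl⟩ := hu
    have : ((t, 0) : ℝ × Y) = t • (1, 0) := by simp
    rw [this, map_smul, smul_eq_mul, mul_eq_zero, or_iff_left ha2] at hu1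
    simp [hu1]
  have hζ0 : ζ 0 = 0 := by simp [ζ, ha1]
  obtain ⟨ρ, hρ, hρ0, -, hρr⟩ := hζ.exists_inverse
  rw [hζ0] at hρ hρ0 hρr
  have hin : SmoothNear (fun y : Y => ((0 : ℝ), y)) 0 :=
    (contDiff_const.prodMk contDiff_id).smoothNear
  have hin0 : Filter.Tendsto (fun y : Y => ((0 : ℝ), y)) (𝓝 0) (𝓝 0) := hin.continuousAt
  refine ⟨fun y => (ρ (0, y)).1, ?_, ?_, ?_⟩
  · exact (contDiff_fst (n := ∞)).smoothNear.comp
      (SmoothNear.comp (f := fun y : Y => ((0 : ℝ), y)) hρ.1 hin)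
  · change (ρ 0).1 = 0
    rw [hρ0]; rfl
  · filter_upwards [hin0.eventually hρr] with y hy
    have h2 : (ρ (0, y)).2 = y := congrArg Prod.snd hy
    have h3 : fderiv ℝ a (ρ (0, y)) (1, 0) = 0 := congrArg Prod.fst hy
    have h4 : ρ (0, y) = ((ρ (0, y)).1, y) := Prod.ext rfl h2
    rwa [h4] at h3

/-- Taylor's formula of order two in `t`, with parameter `y`. -/
theorem SmoothNear.exists_eq_add_sq_mul {a : ℝ × Y → ℝ} (ha : SmoothNear a 0)
    (hcrit : ∀ᶠ y in 𝓝 (0 : Y), fderiv ℝ a (0, y) (1, 0) = 0) :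
    ∃ u : ℝ × Y → ℝ, ContDiff ℝ ∞ u ∧
      fderiv ℝ (fun p => fderiv ℝ a p (1, 0)) 0 (1, 0) = 2 * u 0 ∧
      ∀ᶠ p in 𝓝 (0 : ℝ × Y), a p = a (0, p.2) + p.1 ^ 2 * u p := by
  have hin : Filter.Tendsto (fun y : Y => ((0 : ℝ), y)) (𝓝 0) (𝓝 0) :=
    Continuous.tendsto' (by fun_prop) _ _ rfl
  have hpr : SmoothNear (fun p : ℝ × Y => ((0 : ℝ), p.2)) 0 :=
    (contDiff_const.prodMk contDiff_snd).smoothNear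
  have ha0 : SmoothNear (fun p => a p - a (0, p.2)) (0, 0) :=
    ha.sub (SmoothNear.comp (f := fun p : ℝ × Y => ((0 : ℝ), p.2)) ha hpr)
  obtain ⟨g, hg, hag⟩ := ha0.exists_eq_smul (Filter.Eventually.of_forall fun y => by simp)
  have hg0 : ∀ᶠ y in 𝓝 (0 : Y), g (0, y) = 0 := by
    filter_upwards [hcrit, hin.eventually (eventually_eventually_nhds.2 hag),
      hin.eventually ha.eventually] with y h1 h2 h3
    have h4 := h3.hasDerivAt_slice
    rw [h1] at h4
    have h5 : Filter.Tendsto (fun r : ℝ => (r, y)) (𝓝 0) (𝓝 (0, y)) :=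
      Continuous.tendsto' (by fun_prop) _ _ rfl
    have h6 : HasDerivAt (fun r : ℝ => g (r, y)) _ 0 :=
      (hg.smoothNear (x := ((0 : ℝ), y))).hasDerivAt_slice
    have h7 : HasDerivAt (fun r => r * g (r, y) + a (0, y)) _ 0 :=
      ((hasDerivAt_id (0 : ℝ)).mul h6).add_const (a (0, y))
    have h8 : (fun r => a (r, y)) =ᶠ[𝓝 0] fun r => r * g (r, y) + a (0, y) := by
      filter_upwards [h5.eventually h2] with r hr
      simp only [smul_eq_mul] at hr
      linarith
    have h9 := h4.unique (h7.congr_of_eventuallyEq h8)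
    simpa using h9.symm
  obtain ⟨u, hu, hgu⟩ := (hg.smoothNear (x := ((0 : ℝ), (0 : Y)))).exists_eq_smul hg0
  have hau : ∀ᶠ p in 𝓝 (0 : ℝ × Y), a p = a (0, p.2) + p.1 ^ 2 * u p := by
    filter_upwards [hag, hgu] with p h1 h2
    simp only [smul_eq_mul] at h1 h2
    rw [h2] at h1
    linarith
  refine ⟨u, hu, ?_, hau⟩
  have hline : Filter.Tendsto (fun r : ℝ => (r, (0 : Y))) (𝓝 0) (𝓝 0) :=
    Continuous.tendsto' (by fun_prop) _ _ rfl
  have hus : ∀ r : ℝ, HasDerivAt (fun r : ℝ => u (r, 0)) (fderiv ℝ u (r, 0) (1, 0)) r :=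
    fun r => hu.smoothNear.hasDerivAt_slice
  have h1 : (fun r : ℝ => fderiv ℝ a (r, 0) (1, 0)) =ᶠ[𝓝 0]
      fun r => r * (2 * u (r, 0) + r * fderiv ℝ u (r, 0) (1, 0)) := by
    filter_upwards [hline.eventually ha.eventually,
      hline.eventually (eventually_eventually_nhds.2 hau)] with r h1 h2
    have h3 : (fun r : ℝ => a (r, 0)) =ᶠ[𝓝 r] fun r => a (0, 0) + r ^ 2 * u (r, 0) := by
      have : Filter.Tendsto (fun r : ℝ => (r, (0 : Y))) (𝓝 r) (𝓝 (r, 0)) :=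
        Continuous.tendsto' (by fun_prop) _ _ rfl
      exact this.eventually h2
    have h4 : HasDerivAt (fun r => a (0, 0) + r ^ 2 * u (r, 0)) _ r :=
      ((hasDerivAt_pow 2 r).mul (hus r)).const_add (a (0, 0))
    rw [h1.hasDerivAt_slice.unique (h4.congr_of_eventuallyEq h3)]
    push_cast
    ring
  have h2 : HasDerivAt (fun r : ℝ => fderiv ℝ a (r, 0) (1, 0))
      (fderiv ℝ (fun p => fderiv ℝ a p (1, 0)) 0 (1, 0)) 0 :=
    SmoothNear.hasDerivAt_slice (a := fun p => fderiv ℝ a p (1, 0)) (ha.fderiv_apply (1, 0))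
  have hk : DifferentiableAt ℝ
      (fun r : ℝ => 2 * u (r, 0) + r * fderiv ℝ u (r, 0) (1, 0)) 0 := by
    have h3 : SmoothNear (fun p : ℝ × Y => fderiv ℝ u p (1, 0)) ((0 : ℝ), (0 : Y)) :=
      hu.smoothNear.fderiv_apply (1, 0)
    exact (((hus 0).const_mul 2).add
      ((hasDerivAt_id (0 : ℝ)).mul h3.hasDerivAt_slice)).differentiableAt
  have h3 := ((hasDerivAt_id (0 : ℝ)).mul hk.hasDerivAt).congr_of_eventuallyEq h1
  rw [h2.unique h3]
  simp only [one_mul, id, zero_mul, add_zero]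
  rfl

/-- The Morse lemma with parameters, for the first component of `c`. -/
theorem exists_germEquiv_sq {c : ℝ × Y → ℝ × Y} (hc : SmoothNear c 0)
    (hc1 : fderiv ℝ c 0 = 0) (hc2 : fderiv ℝ (fun p => fderiv ℝ c p (1, 0)) 0 (1, 0) = (1, 0)) :
    ∃ b : ℝ × Y → Y, SmoothNear b 0 ∧
      GermEquiv (fun p : ℝ × Y => (p.2, c p)) 0 (fun p : ℝ × Y => (p.2, (p.1 ^ 2, b p))) 0 := by
  let a : ℝ × Y → ℝ := fun p => (c p).1
  have ha : SmoothNear a 0 := (contDiff_fst (n := ∞)).smoothNear.comp hc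
  have had : ∀ᶠ p in 𝓝 (0 : ℝ × Y), ∀ v, fderiv ℝ a p v = (fderiv ℝ c p v).1 := by
    filter_upwards [hc.eventually] with p hp v
    have : HasFDerivAt (fun p => (c p).1) _ p :=
      (ContinuousLinearMap.fst ℝ ℝ Y).hasFDerivAt.comp p hp.hasFDerivAt
    rw [this.fderiv]
    rfl
  have ha1 : fderiv ℝ a 0 (1, 0) = 0 := by rw [had.self_of_nhds, hc1]; rfl
  have ha2 : fderiv ℝ (fun p => fderiv ℝ a p (1, 0)) 0 (1, 0) = 1 := by
    have h1 : (fun p => fderiv ℝ a p (1, 0)) =ᶠ[𝓝 0] fun p => (fderiv ℝ c p (1, 0)).1 := by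
      filter_upwards [had] with p hp
      exact hp _
    have h2 : HasFDerivAt (fun p => (fderiv ℝ c p (1, 0)).1) _ 0 :=
      (ContinuousLinearMap.fst ℝ ℝ Y).hasFDerivAt.comp 0 (hc.fderiv_apply (1, 0)).hasFDerivAt
    rw [h1.fderiv_eq, h2.fderiv]
    exact congrArg Prod.fst hc2
  obtain ⟨τ, hτ, hτ0, hτc⟩ := exists_smoothNear_critical ha ha1 (by rw [ha2]; exact one_ne_zero)
  -- translate `t` so that the critical points lie on `t = 0`
  let σ : ℝ × Y → ℝ × Y := fun p => (p.1 + τ p.2, p.2)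
  have hσ0 : σ 0 = 0 := by simp [σ, hτ0]
  have hσs : SmoothNear σ 0 :=
    ((contDiff_fst (n := ∞)).smoothNear.add
      (SmoothNear.comp (f := fun p : ℝ × Y => p.2) hτ (contDiff_snd (n := ∞)).smoothNear)).prodMk
      (contDiff_snd (n := ∞)).smoothNear
  have hσd : HasFDerivAt σ (((ContinuousLinearMap.fst ℝ ℝ Y) +
      (fderiv ℝ τ 0).comp (ContinuousLinearMap.snd ℝ ℝ Y)).prod (ContinuousLinearMap.snd ℝ ℝ Y)) 0 :=
    ((ContinuousLinearMap.fst ℝ ℝ Y).hasFDerivAt.add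
      (HasFDerivAt.comp (f := fun p : ℝ × Y => p.2) (0 : ℝ × Y) hτ.hasFDerivAt
        (ContinuousLinearMap.snd ℝ ℝ Y).hasFDerivAt)).prodMk
      (ContinuousLinearMap.snd ℝ ℝ Y).hasFDerivAt
  have hσ : IsDiffeoGerm σ 0 := by
    refine IsDiffeoGerm.of_hasFDerivAt rfl hσs hσd fun u hu => ?_
    obtain ⟨t, y⟩ := u
    simp only [ContinuousLinearMap.prod_apply, ContinuousLinearMap.coe_snd',
      Prod.mk_eq_zero, add_apply, ContinuousLinearMap.coe_fst',
      ContinuousLinearMap.comp_apply] at hu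
    obtain ⟨hu1, rfl⟩ := hu
    simpa using hu1
  have hσt : Filter.Tendsto σ (𝓝 0) (𝓝 0) := by
    have := hσs.continuousAt.tendsto
    rwa [hσ0] at this
  have hcσ : SmoothNear (fun p => c (σ p)) 0 := SmoothNear.comp (by rwa [hσ0]) hσs
  let a₁ : ℝ × Y → ℝ := fun p => a (σ p)
  have ha₁ : SmoothNear a₁ 0 := (contDiff_fst (n := ∞)).smoothNear.comp hcσ
  have hda₁ : ∀ᶠ p in 𝓝 (0 : ℝ × Y), fderiv ℝ a₁ p (1, 0) = fderiv ℝ a (σ p) (1, 0) := by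
    filter_upwards [ha₁.eventually, hσt.eventually ha.eventually] with p h1 h2
    have h3 := h1.hasDerivAt_slice (t := p.1) (y := p.2)
    have h4 := HasDerivAt.comp_add_const p.1 (τ p.2)
      (h2.hasDerivAt_slice (t := p.1 + τ p.2) (y := p.2))
    exact h3.unique h4
  have hin : Filter.Tendsto (fun y : Y => ((0 : ℝ), y)) (𝓝 0) (𝓝 0) :=
    Continuous.tendsto' (by fun_prop) _ _ rfl
  obtain ⟨u, hu, hu2, hau⟩ := ha₁.exists_eq_add_sq_mul (by
    filter_upwards [hτc, hin.eventually hda₁] with y h1 h2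
    have h3 : σ (0, y) = (τ y, y) := by simp [σ]
    rw [h2, h3, h1])
  have hu0 : 0 < u 0 := by
    have h1 : HasFDerivAt (fun p => fderiv ℝ a (σ p) (1, 0)) _ 0 :=
      HasFDerivAt.comp (f := σ) (g := fun q => fderiv ℝ a q (1, 0)) (0 : ℝ × Y)
        (by rw [hσ0]; exact (ha.fderiv_apply (1, 0)).hasFDerivAt) hσd
    have h2 : (fun p => fderiv ℝ a₁ p (1, 0)) =ᶠ[𝓝 0] fun p => fderiv ℝ a (σ p) (1, 0) := hda₁
    rw [h2.fderiv_eq, h1.fderiv] at hu2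
    have h3 : (((ContinuousLinearMap.fst ℝ ℝ Y) + (fderiv ℝ τ 0).comp
        (ContinuousLinearMap.snd ℝ ℝ Y)).prod (ContinuousLinearMap.snd ℝ ℝ Y)) (1, 0) = (1, 0) := by
      simp
    rw [ContinuousLinearMap.comp_apply, h3, ha2] at hu2
    linarith
  -- absorb the unit `u` into `t`
  let s : ℝ × Y → ℝ := fun p => Real.sqrt (u p)
  have hs : SmoothNear s 0 := by
    filter_upwards [hu.continuous.continuousAt.eventually (lt_mem_nhds hu0)] with p hp
    exact hu.contDiffAt.sqrt hp.ne'
  have hs0 : 0 < s 0 := Real.sqrt_pos.2 hu0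
  let χ : ℝ × Y → ℝ × Y := fun p => (p.1 * s p, p.2)
  have hχs : SmoothNear χ 0 :=
    (SmoothNear.smul (contDiff_fst (n := ∞)).smoothNear hs).prodMk
      (contDiff_snd (n := ∞)).smoothNear
  have hχd := ((ContinuousLinearMap.fst ℝ ℝ Y).hasFDerivAt.mul hs.hasFDerivAt).prodMk
    (ContinuousLinearMap.snd ℝ ℝ Y).hasFDerivAt
  have hχ : IsDiffeoGerm χ 0 := by
    refine IsDiffeoGerm.of_hasFDerivAt rfl hχs hχd fun v hv => ?_
    obtain ⟨t, y⟩ := v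
    simpa [hs0.ne'] using hv
  have hχ0 : χ 0 = 0 := by simp [χ]
  obtain ⟨κ, hκ, hκ0, hκl, -⟩ := hχ.exists_inverse
  rw [hχ0] at hκ hκ0
  let b : ℝ × Y → Y := fun p => (c (σ (κ p))).2
  have hb : SmoothNear b 0 :=
    (contDiff_snd (n := ∞)).smoothNear.comp
      (SmoothNear.comp (g := fun p => c (σ p)) (by rwa [hκ0]) hκ.1)
  have hT : GermEquiv (fun p : ℝ × Y => (p.2, c p)) 0 (fun p : ℝ × Y => (p.2, c (σ p))) 0 := by
    have := GermEquiv.of_comp (g := fun p : ℝ × Y => (p.2, c p)) hσ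
    rwa [hσ0] at this
  refine ⟨b, hb, hT.trans ?_⟩
  -- subtract the critical values in the target
  let α : Y → ℝ := fun y => a₁ (0, y)
  have hα : SmoothNear α 0 := SmoothNear.comp (f := fun y : Y => ((0 : ℝ), y)) ha₁
    (contDiff_const.prodMk contDiff_id).smoothNear
  let ψ : Y × (ℝ × Y) → Y × (ℝ × Y) := fun q => (q.1, (q.2.1 - α q.1, q.2.2))
  have hbase : SmoothNear α ((fun p : ℝ × Y => (p.2, c (σ p))) 0).1 := hα
  set q₀ := (fun p : ℝ × Y => (p.2, c (σ p))) 0 with hq₀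
  have hfst : SmoothNear (fun q : Y × (ℝ × Y) => q.1) q₀ := (contDiff_fst (n := ∞)).smoothNear
  have h21 : SmoothNear (fun q : Y × (ℝ × Y) => q.2.1) q₀ :=
    (contDiff_fst.comp contDiff_snd : ContDiff ℝ ∞ fun q : Y × (ℝ × Y) => q.2.1).smoothNear
  have h22 : SmoothNear (fun q : Y × (ℝ × Y) => q.2.2) q₀ :=
    (contDiff_snd.comp contDiff_snd : ContDiff ℝ ∞ fun q : Y × (ℝ × Y) => q.2.2).smoothNear
  have hαq : SmoothNear (fun q : Y × (ℝ × Y) => α q.1) q₀ := hbase.comp hfst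
  have hψs : SmoothNear ψ q₀ := hfst.prodMk ((h21.sub hαq).prodMk h22)
  have hψ : IsDiffeoGerm ψ q₀ := by
    refine IsDiffeoGerm.of_hasFDerivAt rfl hψs (χ' := (ContinuousLinearMap.fst ℝ Y (ℝ × Y)).prod
      ((((ContinuousLinearMap.fst ℝ ℝ Y).comp (ContinuousLinearMap.snd ℝ Y (ℝ × Y))) -
        (fderiv ℝ α q₀.1).comp (ContinuousLinearMap.fst ℝ Y (ℝ × Y))).prod
        ((ContinuousLinearMap.snd ℝ ℝ Y).comp (ContinuousLinearMap.snd ℝ Y (ℝ × Y))))) ?_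
      fun v hv => ?_
    · refine (ContinuousLinearMap.fst ℝ Y (ℝ × Y)).hasFDerivAt.prodMk (HasFDerivAt.prodMk ?_
        ((ContinuousLinearMap.snd ℝ ℝ Y).comp (ContinuousLinearMap.snd ℝ Y (ℝ × Y))).hasFDerivAt)
      exact ((ContinuousLinearMap.fst ℝ ℝ Y).comp
        (ContinuousLinearMap.snd ℝ Y (ℝ × Y))).hasFDerivAt.sub
        (hbase.hasFDerivAt.comp q₀ (ContinuousLinearMap.fst ℝ Y (ℝ × Y)).hasFDerivAt)
    · obtain ⟨y, t, z⟩ := v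
      simp only [ContinuousLinearMap.prod_apply, ContinuousLinearMap.coe_fst', sub_apply,
        ContinuousLinearMap.comp_apply, ContinuousLinearMap.coe_snd', Prod.mk_eq_zero] at hv
      obtain ⟨rfl, h1, rfl⟩ := hv
      simpa using h1
  refine ⟨χ, ψ, hχ, hχ0, hψ, ?_⟩
  filter_upwards [hau, hκl, hu.continuous.continuousAt.eventually (lt_mem_nhds hu0)] with p h1 h2 h3
  have h4 : a₁ p - α p.2 = (p.1 * s p) ^ 2 := by
    rw [h1, mul_pow, Real.sq_sqrt h3.le]
    simp [α]
  simp only [ψ, b, h2]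
  refine Prod.ext rfl (Prod.ext h4 rfl)

end Morse

/-! ### The normal form of a non-degenerate germ -/

section Umbrella

/-- The cross-cap `(t, y) ↦ (y, t ^ 2, t y)`, with the components in the order that suits
coordinates in which the map is a graph. -/
def whitneyUmbrella (Y : Type*) [NormedAddCommGroup Y] [NormedSpace ℝ Y] (p : ℝ × Y) :
    Y × (ℝ × Y) :=
  (p.2, (p.1 ^ 2, p.1 • p.2))

theorem contDiff_whitneyUmbrella (Y : Type*) [NormedAddCommGroup Y] [NormedSpace ℝ Y] :
    ContDiff ℝ ∞ (whitneyUmbrella Y) :=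
  contDiff_snd.prodMk ((contDiff_fst.pow 2).prodMk (contDiff_fst.smul contDiff_snd))

theorem SmoothNear.exists_eq_even_add_odd_euclidean {Y : Type} [NormedAddCommGroup Y]
    [NormedSpace ℝ Y] [FiniteDimensional ℝ Y] {n : ℕ} {f : ℝ × Y → EuclideanSpace ℝ (Fin n)}
    (hf : SmoothNear f 0) : ∃ A B : ℝ × Y → EuclideanSpace ℝ (Fin n),
      ContDiff ℝ ∞ A ∧ ContDiff ℝ ∞ B ∧
      ∀ᶠ p in 𝓝 (0 : ℝ × Y), f p = A (p.1 ^ 2, p.2) + p.1 • B (p.1 ^ 2, p.2) := by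
  have hi : ∀ i, SmoothNear (fun p => f p i) 0 := fun i =>
    (EuclideanSpace.proj (𝕜 := ℝ) i).contDiff.smoothNear.comp hf
  choose A B hA hB h using fun i => (hi i).exists_eq_even_add_odd
  refine ⟨fun p => WithLp.toLp 2 fun i => A i p, fun p => WithLp.toLp 2 fun i => B i p,
    contDiff_euclidean.2 hA, contDiff_euclidean.2 hB, ?_⟩
  filter_upwards [Filter.eventually_all.2 h] with p hp
  ext i
  simp [hp i]

variable {Y : Type*} [NormedAddCommGroup Y] [NormedSpace ℝ Y]

/-- For `(t, y) ↦ (y, t ^ 2, t B (t ^ 2, y))`, non-degeneracy implies that `y ↦ B (0, y)` is a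
local diffeomorphism at the origin that fixes it. -/
theorem IsNondegenerateAt.of_odd {B : ℝ × Y → Y} (hB : ContDiff ℝ ∞ B)
    (h : IsNondegenerateAt (fun p : ℝ × Y => (p.2, (p.1 ^ 2, p.1 • B (p.1 ^ 2, p.2)))) 0) :
    B 0 = 0 ∧ ∀ y, fderiv ℝ B 0 (0, y) = 0 → y = 0 := by
  set g : ℝ × Y → Y × (ℝ × Y) := fun p => (p.2, (p.1 ^ 2, p.1 • B (p.1 ^ 2, p.2))) with hgdef
  have hB2 : ContDiff ℝ ∞ fun p : ℝ × Y => B (p.1 ^ 2, p.2) :=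
    hB.comp ((contDiff_fst.pow 2).prodMk contDiff_snd)
  have hg : ContDiff ℝ ∞ g :=
    contDiff_snd.prodMk ((contDiff_fst.pow 2).prodMk (contDiff_fst.smul hB2))
  have hslice : ∀ y, fderiv ℝ g (0, y) (1, 0) = (0, (0, B (0, y))) := by
    intro y
    have h1 : HasDerivAt (fun r : ℝ => g (r, y)) _ 0 := hg.smoothNear.hasDerivAt_slice
    have h2 : HasDerivAt (fun r : ℝ => B (r ^ 2, y)) _ 0 :=
      (hB2.smoothNear (x := ((0 : ℝ), y))).hasDerivAt_slice
    have h3 : HasDerivAt (fun r : ℝ => g (r, y)) _ 0 :=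
      (hasDerivAt_const (0 : ℝ) y).prodMk ((hasDerivAt_pow 2 (0 : ℝ)).prodMk
        ((hasDerivAt_id (0 : ℝ)).smul h2))
    rw [h1.unique h3]
    simp
  have h00 : ((0 : ℝ), (0 : Y)) = 0 := rfl
  obtain ⟨⟨⟨t, y⟩, hv, hv0⟩, hnd⟩ := h
  have hy : y = 0 := by
    have h1 : HasFDerivAt (fun p => (g p).1) _ 0 :=
      (ContinuousLinearMap.fst ℝ Y (ℝ × Y)).hasFDerivAt.comp 0 (hg.smoothNear (x := 0)).hasFDerivAt
    have h2 : HasFDerivAt (fun p => (g p).1) (ContinuousLinearMap.snd ℝ ℝ Y) 0 :=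
      (ContinuousLinearMap.snd ℝ ℝ Y).hasFDerivAt
    have h3 := DFunLike.congr_fun (h1.unique h2) (t, y)
    rw [ContinuousLinearMap.comp_apply, hv0] at h3
    exact h3.symm
  subst hy
  have ht : t ≠ 0 := fun h => hv (by rw [h]; rfl)
  have hte : ((t, 0) : ℝ × Y) = t • (1, 0) := by simp
  rw [hte, map_smul, smul_eq_zero, or_iff_right ht] at hv0
  have hB0 : B 0 = 0 := by
    have h1 := hslice 0
    rw [h00, hv0] at h1
    exact (congrArg (fun q : Y × (ℝ × Y) => q.2.2) h1).symm
  refine ⟨hB0, fun y hy => ?_⟩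
  have h1 : fderiv ℝ (fun p => fderiv ℝ g p (1, 0)) 0 (0, y) = 0 := by
    have hl : HasDerivAt (fun r : ℝ => ((0 : ℝ), r • y)) (0, y) 0 := by
      have := (hasDerivAt_const (0 : ℝ) (0 : ℝ)).prodMk ((hasDerivAt_id (0 : ℝ)).smul_const y)
      simpa using this
    have hl0 : ((0 : ℝ), (0 : ℝ) • y) = 0 := by simp
    have h2 : HasDerivAt (fun r : ℝ => fderiv ℝ g (0, r • y) (1, 0)) _ 0 :=
      HasFDerivAt.comp_hasDerivAt (f := fun r : ℝ => ((0 : ℝ), r • y))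
        (l := fun p => fderiv ℝ g p (1, 0)) (0 : ℝ)
        (by rw [hl0]; exact ((hg.smoothNear (x := 0)).fderiv_apply (1, 0)).hasFDerivAt) hl
    have h3 : HasDerivAt (fun r : ℝ => B (0, r • y)) _ 0 :=
      HasFDerivAt.comp_hasDerivAt (f := fun r : ℝ => ((0 : ℝ), r • y)) (0 : ℝ)
        (by rw [hl0]; exact (hB.smoothNear (x := 0)).hasFDerivAt) hl
    have h4 : HasDerivAt (fun r : ℝ => ((0 : Y), ((0 : ℝ), B (0, r • y)))) _ 0 :=
      (hasDerivAt_const (0 : ℝ) (0 : Y)).prodMk ((hasDerivAt_const (0 : ℝ) (0 : ℝ)).prodMk h3)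
    have h5 : (fun r : ℝ => fderiv ℝ g (0, r • y) (1, 0)) =
        fun r : ℝ => ((0 : Y), ((0 : ℝ), B (0, r • y))) := funext fun r => hslice _
    rw [h5] at h2
    rw [h2.unique h4, hy]
    rfl
  have h2 := hnd (1, 0) (by simp) hv0 (0, y) (by rw [h1]; exact zero_mem _)
  exact congrArg Prod.snd h2

variable [FiniteDimensional ℝ Y]

/-- Once `t ^ 2` is a component, the even part of the rest is removed in the target, and the odd
part is linearised by a change of coordinates that is carried out in the source and in the target
at the same time. -/
theorem germEquiv_whitneyUmbrella {A B b : ℝ × Y → Y} (hb : SmoothNear b 0)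
    (hA : ContDiff ℝ ∞ A) (hB : ContDiff ℝ ∞ B)
    (hAB : ∀ᶠ p in 𝓝 (0 : ℝ × Y), b p = A (p.1 ^ 2, p.2) + p.1 • B (p.1 ^ 2, p.2))
    (h : IsNondegenerateAt (fun p : ℝ × Y => (p.2, (p.1 ^ 2, b p))) 0) :
    GermEquiv (fun p : ℝ × Y => (p.2, (p.1 ^ 2, b p))) 0 (whitneyUmbrella Y) 0 := by
  set g : ℝ × Y → Y × (ℝ × Y) := fun p => (p.2, (p.1 ^ 2, b p))
  let g₁ : ℝ × Y → Y × (ℝ × Y) := fun p => (p.2, (p.1 ^ 2, p.1 • B (p.1 ^ 2, p.2)))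
  have hg : SmoothNear g 0 :=
    (contDiff_snd (n := ∞)).smoothNear.prodMk ((contDiff_fst.pow 2 (n := ∞)).smoothNear.prodMk hb)
  have hB2 : ContDiff ℝ ∞ fun p : ℝ × Y => B (p.1 ^ 2, p.2) :=
    hB.comp ((contDiff_fst.pow 2).prodMk contDiff_snd)
  have hg₁ : ContDiff ℝ ∞ g₁ :=
    contDiff_snd.prodMk ((contDiff_fst.pow 2).prodMk (contDiff_fst.smul hB2))
  have hsw : ContDiff ℝ ∞ fun q : Y × (ℝ × Y) => (q.2.1, q.1) :=
    (contDiff_fst.comp contDiff_snd).prodMk contDiff_fst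
  let sw : Y × (ℝ × Y) →L[ℝ] ℝ × Y := ((ContinuousLinearMap.fst ℝ ℝ Y).comp
    (ContinuousLinearMap.snd ℝ Y (ℝ × Y))).prod (ContinuousLinearMap.fst ℝ Y (ℝ × Y))
  have h22 : ContDiff ℝ ∞ fun q : Y × (ℝ × Y) => q.2.2 := contDiff_snd.comp contDiff_snd
  have h21 : ContDiff ℝ ∞ fun q : Y × (ℝ × Y) => q.2.1 := contDiff_fst.comp contDiff_snd
  have e1 : GermEquiv g 0 g₁ 0 := by
    let ψ : Y × (ℝ × Y) → Y × (ℝ × Y) := fun q => (q.1, (q.2.1, q.2.2 - A (q.2.1, q.1)))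
    have hψs : ContDiff ℝ ∞ ψ := contDiff_fst.prodMk (h21.prodMk (h22.sub (hA.comp hsw)))
    have hψd : HasFDerivAt ψ ((ContinuousLinearMap.fst ℝ Y (ℝ × Y)).prod
        (((ContinuousLinearMap.fst ℝ ℝ Y).comp (ContinuousLinearMap.snd ℝ Y (ℝ × Y))).prod
        (((ContinuousLinearMap.snd ℝ ℝ Y).comp (ContinuousLinearMap.snd ℝ Y (ℝ × Y))) -
          (fderiv ℝ A (sw (g 0))).comp sw))) (g 0) := by
      refine (ContinuousLinearMap.fst ℝ Y (ℝ × Y)).hasFDerivAt.prodMk (HasFDerivAt.prodMk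
        ((ContinuousLinearMap.fst ℝ ℝ Y).comp (ContinuousLinearMap.snd ℝ Y (ℝ × Y))).hasFDerivAt ?_)
      exact ((ContinuousLinearMap.snd ℝ ℝ Y).comp
        (ContinuousLinearMap.snd ℝ Y (ℝ × Y))).hasFDerivAt.sub
        (hA.smoothNear.hasFDerivAt.comp (g 0) sw.hasFDerivAt)
    refine ⟨fun p => p, ψ, isDiffeoGerm_id 0, rfl,
      IsDiffeoGerm.of_hasFDerivAt rfl hψs.smoothNear hψd fun v hv => ?_, ?_⟩
    · obtain ⟨y, t, z⟩ := v
      simp only [ContinuousLinearMap.prod_apply, ContinuousLinearMap.coe_fst', sub_apply,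
        ContinuousLinearMap.comp_apply, ContinuousLinearMap.coe_snd', Prod.mk_eq_zero, sw] at hv
      obtain ⟨rfl, rfl, h1⟩ := hv
      rw [show ((0 : ℝ), (0 : Y)) = 0 from rfl, map_zero, sub_zero] at h1
      rw [h1]; rfl
    · filter_upwards [hAB] with p hp
      simp only [ψ, g, g₁, hp, add_sub_cancel_left]
  obtain ⟨hB0, hBinj⟩ := (h.of_germEquiv hg hg₁.smoothNear e1).of_odd hB
  refine e1.trans ?_
  let χ : ℝ × Y → ℝ × Y := fun p => (p.1, B (p.1 ^ 2, p.2))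
  have hχs : ContDiff ℝ ∞ χ := contDiff_fst.prodMk hB2
  have hχd : HasFDerivAt χ ((ContinuousLinearMap.fst ℝ ℝ Y).prod ((fderiv ℝ B 0).comp
      ((0 : ℝ × Y →L[ℝ] ℝ).prod (ContinuousLinearMap.snd ℝ ℝ Y)))) 0 := by
    refine (ContinuousLinearMap.fst ℝ ℝ Y).hasFDerivAt.prodMk ?_
    have h1 : HasFDerivAt (fun p : ℝ × Y => (p.1 ^ 2, p.2))
        ((0 : ℝ × Y →L[ℝ] ℝ).prod (ContinuousLinearMap.snd ℝ ℝ Y)) 0 := by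
      refine HasFDerivAt.prodMk ?_ (ContinuousLinearMap.snd ℝ ℝ Y).hasFDerivAt
      have := (ContinuousLinearMap.fst ℝ ℝ Y).hasFDerivAt (x := 0) |>.pow 2
      simpa using this
    refine HasFDerivAt.comp (f := fun p : ℝ × Y => (p.1 ^ 2, p.2)) (0 : ℝ × Y) ?_ h1
    have h0 : (((0 : ℝ × Y).1 ^ 2, (0 : ℝ × Y).2) : ℝ × Y) = 0 := by simp
    rw [h0]
    exact hB.smoothNear.hasFDerivAt
  have hχ : IsDiffeoGerm χ 0 := by
    refine IsDiffeoGerm.of_hasFDerivAt rfl hχs.smoothNear hχd fun v hv => ?_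
    obtain ⟨t, y⟩ := v
    simp only [ContinuousLinearMap.prod_apply, ContinuousLinearMap.coe_fst', zero_apply,
      ContinuousLinearMap.comp_apply, ContinuousLinearMap.coe_snd', Prod.mk_eq_zero] at hv
    obtain ⟨rfl, h1⟩ := hv
    rw [hBinj y h1]; rfl
  have hχ0 : χ 0 = 0 := by
    have hB00 : B (0, 0) = 0 := hB0
    simp [χ, hB00]
  let ψ : Y × (ℝ × Y) → Y × (ℝ × Y) := fun q => (B (q.2.1, q.1), q.2)
  have hψs : ContDiff ℝ ∞ ψ := (hB.comp hsw).prodMk contDiff_snd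
  have hg0 : g₁ 0 = 0 := by simp [g₁]
  have hψd : HasFDerivAt ψ (((fderiv ℝ B 0).comp sw).prod (ContinuousLinearMap.snd ℝ Y (ℝ × Y)))
      (g₁ 0) := by
    rw [hg0]
    refine HasFDerivAt.prodMk ?_ (ContinuousLinearMap.snd ℝ Y (ℝ × Y)).hasFDerivAt
    exact HasFDerivAt.comp (f := sw) (0 : Y × (ℝ × Y))
      (by rw [map_zero]; exact hB.smoothNear.hasFDerivAt) sw.hasFDerivAt
  refine ⟨χ, ψ, hχ, hχ0, IsDiffeoGerm.of_hasFDerivAt rfl hψs.smoothNear hψd fun v hv => ?_,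
    Filter.Eventually.of_forall fun p => rfl⟩
  obtain ⟨y, q⟩ := v
  simp only [ContinuousLinearMap.prod_apply, ContinuousLinearMap.coe_fst',
    ContinuousLinearMap.comp_apply, ContinuousLinearMap.coe_snd', Prod.mk_eq_zero, sw] at hv
  obtain ⟨h1, rfl⟩ := hv
  rw [hBinj y h1]; rfl

/-- Whitney's recognition theorem: a non-degenerate map of corank one is a cross-cap. -/
theorem germEquiv_whitneyUmbrella_of_isNondegenerateAt {E F : Type*} [NormedAddCommGroup E]
    [NormedSpace ℝ E] [NormedAddCommGroup F] [NormedSpace ℝ F] [FiniteDimensional ℝ E]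
    [FiniteDimensional ℝ F] {n : ℕ} {g : E → F} {x : E} (hg : SmoothNear g x)
    (hnd : IsNondegenerateAt g x) (hE : Module.finrank ℝ E = n + 1)
    (hF : Module.finrank ℝ F = 2 * n + 1)
    (hr : Module.finrank ℝ (LinearMap.range (fderiv ℝ g x).toLinearMap) = n) :
    GermEquiv g x (whitneyUmbrella (EuclideanSpace ℝ (Fin n))) 0 := by
  have hn : Module.finrank ℝ (EuclideanSpace ℝ (Fin n)) = n := finrank_euclideanSpace_fin
  obtain ⟨c, hc, hc1, hc2, e1⟩ := exists_germEquiv_graph (Y := EuclideanSpace ℝ (Fin n)) hg hnd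
    (by rw [hn, hE]) (by rw [hn, hF]) (by rw [hn, hr])
  obtain ⟨b, hb, e2⟩ := exists_germEquiv_sq hc hc1 hc2
  have e3 := e1.trans e2
  have hs : SmoothNear (fun p : ℝ × EuclideanSpace ℝ (Fin n) => (p.2, (p.1 ^ 2, b p))) 0 :=
    (contDiff_snd (n := ∞)).smoothNear.prodMk ((contDiff_fst.pow 2 (n := ∞)).smoothNear.prodMk hb)
  obtain ⟨A, B, hA, hB, hAB⟩ := hb.exists_eq_even_add_odd_euclidean
  exact e3.trans (germEquiv_whitneyUmbrella hb hA hB hAB (hnd.of_germEquiv hg hs e3))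

end Umbrella

/-! ### Derivatives of maximal minors -/

section Minors

variable {k n : ℕ}

/-- An injective matrix has a non-zero maximal minor. -/
theorem exists_maximalMinors_ne_zero {A : Matrix (Fin k) (Fin n) ℝ}
    (hA : ∀ x, A.mulVec x = 0 → x = 0) : ∃ s, maximalMinors A s ≠ 0 := by
  have hrank : A.rank = n := by
    have h1 := A.mulVecLin.finrank_range_add_finrank_ker
    have h2 : LinearMap.ker A.mulVecLin = ⊥ := by
      rw [LinearMap.ker_eq_bot']
      exact fun x hx => hA x hx
    rw [h2, finrank_bot, Module.finrank_fin_fun] at h1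
    exact h1
  obtain ⟨ι, a, ha, hspan, hli⟩ := exists_linearIndependent' ℝ A.row
  have : Fintype ι := Fintype.ofInjective a ha
  have hcard : Fintype.card ι = n := by
    rw [← finrank_span_eq_card hli, hspan, ← Matrix.rank_eq_finrank_span_row, hrank]
  let s : Finset (Fin k) := Finset.univ.map ⟨a, ha⟩
  have hs : s.card = n := by simp [s, hcard]
  refine ⟨⟨s, hs⟩, ?_⟩
  -- the selected rows, taken in increasing order
  have hmem : ∀ i, ∃ j, a j = s.orderEmbOfFin hs i := by
    intro i
    have := s.orderEmbOfFin_mem hs i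
    simpa only [s, Finset.mem_map, Finset.mem_univ, true_and, Function.Embedding.coeFn_mk] using this
  choose e he using hmem
  have heinj : Function.Injective e := fun i j hij =>
    (s.orderEmbOfFin hs).injective (by rw [← he, ← he, hij])
  have h1 := hli.comp e heinj
  have h2 : (A.submatrix (s.orderEmbOfFin hs) id).row = (A.row ∘ a) ∘ e := by
    funext i j
    change A _ _ = A (a (e i)) j
    rw [he]
    rfl
  rw [← h2, Matrix.linearIndependent_rows_iff_isUnit, Matrix.isUnit_iff_isUnit_det] at h1
  exact h1.ne_zero

/-- If the kernel of `A` is spanned by `v`, then `z` lies in the image of `A` exactly when all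
products of `z` with the adjugates of the maximal square submatrices of `A` vanish. By Cramer's rule,
these products are the maximal minors of `A` with a column replaced by `z`. -/
theorem exists_mulVec_eq_iff_forall_adjugate {A : Matrix (Fin k) (Fin n) ℝ} {v : Fin n → ℝ}
    (hv : v ≠ 0) (hker : ∀ x, A.mulVec x = 0 ↔ ∃ a : ℝ, x = a • v) (z : Fin k → ℝ) :
    (∃ w, A.mulVec w = z) ↔ ∀ s : {s : Finset (Fin k) // s.card = n},
      (A.submatrix (s.1.orderEmbOfFin s.2) id).adjugate.mulVec
        (z ∘ s.1.orderEmbOfFin s.2) = 0 := by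
  have hAv : A.mulVec v = 0 := (hker v).2 ⟨1, by simp⟩
  constructor
  · rintro ⟨w, rfl⟩ s
    have h1 : ∀ x, (A.mulVec x) ∘ (s.1.orderEmbOfFin s.2) =
      (A.submatrix (s.1.orderEmbOfFin s.2) id).mulVec x := fun x => rfl
    have h2 : (A.submatrix (s.1.orderEmbOfFin s.2) id).det = 0 :=
      Matrix.exists_mulVec_eq_zero_iff.1 ⟨v, hv, by rw [← h1, hAv]; rfl⟩
    rw [h1, Matrix.mulVec_mulVec, Matrix.adjugate_mul, h2, zero_smul, Matrix.zero_mulVec]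
  · intro h
    by_contra hz
    obtain ⟨j, hj⟩ := Function.ne_iff.1 hv
    have hcol : ∀ x, (A.updateCol j z).mulVec x =
        A.mulVec (Function.update x j 0) + x j • z := by
      intro x
      funext i
      simp only [Matrix.mulVec, dotProduct, Pi.add_apply, Pi.smul_apply, smul_eq_mul]
      rw [← Finset.add_sum_erase _ _ (Finset.mem_univ j),
        ← Finset.add_sum_erase _ (fun l => A i l * Function.update x j 0 l) (Finset.mem_univ j)]
      have : ∑ l ∈ Finset.univ.erase j, A.updateCol j z i l * x l =
          ∑ l ∈ Finset.univ.erase j, A i l * Function.update x j 0 l := by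
        refine Finset.sum_congr rfl fun l hl => ?_
        have := Finset.ne_of_mem_erase hl
        simp [this]
      rw [this]
      simp
      ring
    obtain ⟨s, hs⟩ := exists_maximalMinors_ne_zero (A := A.updateCol j z) (fun x hx => by
      rw [hcol] at hx
      have hxj : x j = 0 := by
        by_contra hxj
        refine hz ⟨-(x j)⁻¹ • Function.update x j 0, ?_⟩
        rw [Matrix.mulVec_smul, eq_neg_of_add_eq_zero_left hx, smul_neg, neg_smul, neg_neg,
          smul_smul, inv_mul_cancel₀ hxj, one_smul]
      rw [hxj, zero_smul, add_zero, hker] at hx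
      obtain ⟨a, ha⟩ := hx
      have h0 := congrFun ha j
      simp only [Function.update_self, Pi.smul_apply, smul_eq_mul] at h0
      have ha0 : a = 0 := (mul_eq_zero.1 h0.symm).resolve_right hj
      rw [← hxj, Function.update_eq_self, ha0, zero_smul] at ha
      exact ha)
    apply hs
    have h1 := congrFun (h s) j
    rw [← Matrix.cramer_eq_adjugate_mulVec, Matrix.cramer_apply] at h1
    have h2 : (A.submatrix (s.1.orderEmbOfFin s.2) id).updateCol j (z ∘ s.1.orderEmbOfFin s.2) =
        (A.updateCol j z).submatrix (s.1.orderEmbOfFin s.2) id := by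
      ext i l
      simp [Matrix.updateCol_apply]
    rw [h2] at h1
    exact h1

theorem differentiableAt_det {E : Type*} [NormedAddCommGroup E] [NormedSpace ℝ E]
    {M : E → Matrix (Fin n) (Fin n) ℝ} {p : E}
    (hM : ∀ i j, DifferentiableAt ℝ (fun x => M x i j) p) :
    DifferentiableAt ℝ (fun x => (M x).det) p := by
  simp only [Matrix.det_apply]
  refine DifferentiableAt.fun_sum fun σ _ => ?_
  refine DifferentiableAt.const_smul ?_ _
  exact (HasFDerivAt.finsetProd (g := fun i x => M x (σ i) i)
    fun i _ => (hM _ _).hasFDerivAt).differentiableAt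

theorem differentiableAt_adjugate {E : Type*} [NormedAddCommGroup E] [NormedSpace ℝ E]
    {M : E → Matrix (Fin n) (Fin n) ℝ} {p : E}
    (hM : ∀ i j, DifferentiableAt ℝ (fun x => M x i j) p) (i j : Fin n) :
    DifferentiableAt ℝ (fun x => (M x).adjugate i j) p := by
  simp only [Matrix.adjugate_apply]
  refine differentiableAt_det fun a b => ?_
  simp only [Matrix.updateRow_apply]
  split_ifs
  · exact differentiableAt_const _
  · exact hM _ _

/-- The derivative of the determinant at a matrix with `v` in its kernel, obtained from the identity
`adj M · M v = det M • v`. -/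
theorem fderiv_det_smul {E : Type*} [NormedAddCommGroup E] [NormedSpace ℝ E]
    {M : E → Matrix (Fin n) (Fin n) ℝ} {p : E}
    (hM : ∀ i j, DifferentiableAt ℝ (fun x => M x i j) p) {v : Fin n → ℝ}
    (hv : (M p).mulVec v = 0) (u : E) :
    fderiv ℝ (fun x => (M x).det) p u • v =
      (M p).adjugate.mulVec fun i => fderiv ℝ (fun x => (M x).mulVec v i) p u := by
  have hMv : ∀ i, DifferentiableAt ℝ (fun x => (M x).mulVec v i) p := by
    intro i
    simp only [Matrix.mulVec, dotProduct]
    exact DifferentiableAt.fun_sum fun j _ => (hM i j).mul_const _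
  funext i
  have h1 : ∀ x, (M x).det * v i = ∑ j, (M x).adjugate i j * (M x).mulVec v j := by
    intro x
    have : (M x).adjugate.mulVec ((M x).mulVec v) = (M x).det • v := by
      rw [Matrix.mulVec_mulVec, Matrix.adjugate_mul, Matrix.smul_mulVec, Matrix.one_mulVec]
    exact (congrFun this i).symm
  have h2 : HasFDerivAt (fun x => (M x).det * v i) _ p :=
    (differentiableAt_det hM).hasFDerivAt.mul_const (v i)
  have h3 : HasFDerivAt (fun x => ∑ j, (M x).adjugate i j * (M x).mulVec v j) _ p :=
    HasFDerivAt.fun_sum fun j _ =>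
      (differentiableAt_adjugate hM i j).hasFDerivAt.mul (hMv j).hasFDerivAt
  rw [← funext h1] at h3
  have h4 := DFunLike.congr_fun (h2.unique h3) u
  simp only [sum_apply, smul_apply, hv, Pi.zero_apply, zero_smul, add_zero,
    smul_eq_mul] at h4
  simp only [Pi.smul_apply, smul_eq_mul, Matrix.mulVec, dotProduct] at h4 ⊢
  rw [← h4, mul_comm]

theorem jacobian_mulVec (g : EuclideanSpace ℝ (Fin n) → EuclideanSpace ℝ (Fin k))
    (x v : EuclideanSpace ℝ (Fin n)) : (jacobian g x).mulVec v = fderiv ℝ g x v := by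
  have hv : v = ∑ j, v j • EuclideanSpace.single j (1 : ℝ) := by
    ext i
    simp [Pi.single_apply]
  conv_rhs => rw [hv]
  funext i
  simp [jacobian, Matrix.mulVec, dotProduct, mul_comm]

variable {G : EuclideanSpace ℝ (Fin n) → EuclideanSpace ℝ (Fin k)} {p v : EuclideanSpace ℝ (Fin n)}

theorem maximalMinors_jacobian_eq_zero (hv : v ≠ 0) (hGv : fderiv ℝ G p v = 0) :
    maximalMinors (jacobian G p) = 0 := by
  ext s
  refine Matrix.exists_mulVec_eq_zero_iff.1 ⟨v, fun h => hv (by ext i; exact congrFun h i), ?_⟩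
  funext i
  have := congrFun (jacobian_mulVec G p v) (s.1.orderEmbOfFin s.2 i)
  rw [hGv] at this
  exact this

/-- Where the Jacobian matrix has a one-dimensional kernel, spanned by `v`, the derivative of its
maximal minors in the direction `u` vanishes exactly when the second derivative `d²G(u, v)` lies in the
image of `dG`. -/
theorem fderiv_maximalMinors_eq_zero_iff (hG : ContDiff ℝ ∞ G) (hv : v ≠ 0)
    (hker : ∀ x, fderiv ℝ G p x = 0 ↔ ∃ a : ℝ, x = a • v) (u : EuclideanSpace ℝ (Fin n)) :
    fderiv ℝ (fun x => maximalMinors (jacobian G x)) p u = 0 ↔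
      fderiv ℝ (fun x => fderiv ℝ G x v) p u ∈ LinearMap.range (fderiv ℝ G p).toLinearMap := by
  have hGs : SmoothNear G p := hG.smoothNear
  have hJ : ∀ i j, DifferentiableAt ℝ (fun x => jacobian G x i j) p := by
    intro i j
    exact (EuclideanSpace.proj (𝕜 := ℝ) i).differentiableAt.comp p
      (hGs.fderiv_apply (EuclideanSpace.single j 1)).hasFDerivAt.differentiableAt
  have hGv : fderiv ℝ G p v = 0 := (hker v).2 ⟨1, by simp⟩
  set z := fderiv ℝ (fun x => fderiv ℝ G x v) p u with hz
  have hzi : ∀ i, fderiv ℝ (fun x => fderiv ℝ G x v i) p u = z i := by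
    intro i
    have h1 : HasFDerivAt (fun x => fderiv ℝ G x v i) _ p :=
      (EuclideanSpace.proj (𝕜 := ℝ) i).hasFDerivAt.comp p (hGs.fderiv_apply v).hasFDerivAt
    rw [h1.fderiv]
    rfl
  have hμ : ∀ s, fderiv ℝ (fun x => maximalMinors (jacobian G x)) p u s =
      fderiv ℝ (fun x => maximalMinors (jacobian G x) s) p u := by
    intro s
    have hd : DifferentiableAt ℝ (fun x => maximalMinors (jacobian G x)) p :=
      (differentiableAt_euclidean).2 fun s => differentiableAt_det fun i j => hJ _ _
    have h1 : HasFDerivAt (fun x => maximalMinors (jacobian G x) s) _ p :=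
      (EuclideanSpace.proj (𝕜 := ℝ) s).hasFDerivAt.comp p hd.hasFDerivAt
    rw [h1.fderiv]
    rfl
  have hs : ∀ s : {s : Finset (Fin k) // s.card = n},
      fderiv ℝ (fun x => maximalMinors (jacobian G x)) p u s • (v : Fin n → ℝ) =
      ((jacobian G p).submatrix (s.1.orderEmbOfFin s.2) id).adjugate.mulVec
        (z ∘ s.1.orderEmbOfFin s.2) := by
    intro s
    have h1 := fderiv_det_smul (M := fun x => (jacobian G x).submatrix (s.1.orderEmbOfFin s.2) id)
      (p := p) (fun i j => hJ _ _) (v := v) (by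
        funext i
        have := congrFun (jacobian_mulVec G p v) (s.1.orderEmbOfFin s.2 i)
        rw [hGv] at this
        exact this) u
    rw [hμ]
    refine h1.trans ?_
    congr 1
    funext i
    rw [Function.comp_apply, ← hzi]
    congr 2
    funext x
    exact congrFun (jacobian_mulVec G x v) (s.1.orderEmbOfFin s.2 i)
  have hv' : (v : Fin n → ℝ) ≠ 0 := fun h => hv (by ext i; exact congrFun h i)
  have key := exists_mulVec_eq_iff_forall_adjugate (A := jacobian G p) hv' (fun x => by
    have h1 := jacobian_mulVec G p (WithLp.toLp 2 x)
    have h2 := hker (WithLp.toLp 2 x)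
    change (jacobian G p).mulVec x = _ at h1
    rw [h1]
    constructor
    · intro h
      obtain ⟨a, ha⟩ := h2.1 (by ext i; exact congrFun h i)
      exact ⟨a, congrArg WithLp.ofLp ha⟩
    · rintro ⟨a, ha⟩
      have h3 := h2.2 ⟨a, by ext i; exact congrFun ha i⟩
      rw [h3]; rfl) z
  have h1 : z ∈ LinearMap.range (fderiv ℝ G p).toLinearMap ↔
      ∃ w, (jacobian G p).mulVec w = z := by
    constructor
    · rintro ⟨w, hw⟩
      exact ⟨w, by rw [jacobian_mulVec]; exact congrArg WithLp.ofLp hw⟩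
    · rintro ⟨w, hw⟩
      refine ⟨WithLp.toLp 2 w, ?_⟩
      have h2 := jacobian_mulVec G p (WithLp.toLp 2 w)
      change (jacobian G p).mulVec w = _ at h2
      rw [hw] at h2
      ext i
      exact (congrFun h2 i).symm
  rw [h1, key]
  constructor
  · intro h s
    rw [← hs, h]
    simp
  · intro h
    ext s
    have h2 := hs s
    rw [h s, smul_eq_zero, or_iff_left hv'] at h2
    exact h2

end Minors

/-! ### The standard cross-cap -/

section CrossCapForm

theorem fderiv_whitneyUmbrella (Y : Type*) [NormedAddCommGroup Y] [NormedSpace ℝ Y]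
    (p v : ℝ × Y) :
    fderiv ℝ (whitneyUmbrella Y) p v = (v.2, (2 * p.1 * v.1, p.1 • v.2 + v.1 • p.2)) := by
  have h1 : HasFDerivAt (whitneyUmbrella Y) _ p :=
    (ContinuousLinearMap.snd ℝ ℝ Y).hasFDerivAt.prodMk
      (((ContinuousLinearMap.fst ℝ ℝ Y).hasFDerivAt.pow 2).prodMk
        ((ContinuousLinearMap.fst ℝ ℝ Y).hasFDerivAt.smul
          (ContinuousLinearMap.snd ℝ ℝ Y).hasFDerivAt))
  rw [h1.fderiv]
  simp

theorem isNondegenerateAt_whitneyUmbrella (Y : Type*) [NormedAddCommGroup Y] [NormedSpace ℝ Y] :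
    IsNondegenerateAt (whitneyUmbrella Y) 0 := by
  refine ⟨⟨(1, 0), by simp, by rw [fderiv_whitneyUmbrella]; simp⟩, ?_⟩
  rintro ⟨t, y⟩ hv hv0 ⟨s, z⟩ ⟨⟨a, b⟩, hab⟩
  rw [fderiv_whitneyUmbrella] at hv0
  obtain rfl : y = 0 := congrArg Prod.fst hv0
  have ht : t ≠ 0 := fun h => hv (by rw [h]; rfl)
  have h1 : HasFDerivAt (fun p : ℝ × Y => ((0 : Y), (2 * p.1 * t, p.1 • (0 : Y) + t • p.2))) _ 0 :=
    (hasFDerivAt_const (0 : Y) (0 : ℝ × Y)).prodMk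
      ((((ContinuousLinearMap.fst ℝ ℝ Y).hasFDerivAt.const_mul 2).mul_const t).prodMk
        (((ContinuousLinearMap.fst ℝ ℝ Y).hasFDerivAt.smul_const (0 : Y)).add
          ((ContinuousLinearMap.snd ℝ ℝ Y).hasFDerivAt.const_smul t)))
  have h2 : (fun p => fderiv ℝ (whitneyUmbrella Y) p (t, 0)) =
      fun p : ℝ × Y => ((0 : Y), (2 * p.1 * t, p.1 • (0 : Y) + t • p.2)) :=
    funext fun p => fderiv_whitneyUmbrella Y p (t, 0)
  rw [h2, h1.fderiv] at hab
  change fderiv ℝ (whitneyUmbrella Y) 0 (a, b) = _ at hab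
  rw [fderiv_whitneyUmbrella] at hab
  simp [ht] at hab
  obtain ⟨-, h3, h4⟩ := hab
  simp [h3, (smul_eq_zero.1 h4.symm).resolve_left ht]

/-- `crossCapForm` and `whitneyUmbrella` differ by a permutation of the coordinates. -/
theorem germEquiv_crossCapForm (n : ℕ) :
    GermEquiv (whitneyUmbrella (EuclideanSpace ℝ (Fin n))) 0 (crossCapForm (n + 1)) 0 := by
  let Y := EuclideanSpace ℝ (Fin n)
  let κ : ℝ × Y →ₗ[ℝ] EuclideanSpace ℝ (Fin (n + 1)) :=
    { toFun := fun p => WithLp.toLp 2 (Fin.cons p.1 p.2)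
      map_add' := fun p q => by
        ext i
        exact Fin.cases rfl (fun i => rfl) i
      map_smul' := fun c p => by
        ext i
        exact Fin.cases rfl (fun i => rfl) i }
  let lam : Y × (ℝ × Y) →ₗ[ℝ] EuclideanSpace ℝ (Fin (2 * (n + 1) - 1)) :=
    { toFun := fun q => WithLp.toLp 2 fun i : Fin (2 * (n + 1) - 1) =>
        if h0 : i.1 = 0 then q.2.1
        else if hi : i.1 < n + 1 then q.1 ⟨i.1 - 1, by omega⟩
        else q.2.2 ⟨i.1 - (n + 1), by omega⟩
      map_add' := fun p q => by
        ext i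
        simp only [PiLp.add_apply, Prod.fst_add, Prod.snd_add]
        split_ifs <;> rfl
      map_smul' := fun c p => by
        ext i
        simp only [PiLp.smul_apply, Prod.smul_fst, Prod.smul_snd, RingHom.id_apply]
        split_ifs <;> rfl }
  have hκ : IsDiffeoGerm κ 0 := by
    refine IsDiffeoGerm.of_hasFDerivAt (χ' := κ.toContinuousLinearMap) ?_
      κ.toContinuousLinearMap.contDiff.smoothNear κ.toContinuousLinearMap.hasFDerivAt fun v hv => ?_
    · simp [Y, add_comm]
    · refine Prod.ext ?_ ?_
      · exact congrArg (fun w : EuclideanSpace ℝ (Fin (n + 1)) => w 0) hv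
      · ext i
        exact congrArg (fun w : EuclideanSpace ℝ (Fin (n + 1)) => w i.succ) hv
  have hlam : IsDiffeoGerm lam (whitneyUmbrella Y 0) := by
    refine IsDiffeoGerm.of_hasFDerivAt (χ' := lam.toContinuousLinearMap) ?_
      lam.toContinuousLinearMap.contDiff.smoothNear lam.toContinuousLinearMap.hasFDerivAt fun v hv => ?_
    · simp [Y]; omega
    · have hi : ∀ i, lam v i = 0 := fun i =>
        congrArg (fun w : EuclideanSpace ℝ (Fin (2 * (n + 1) - 1)) => w i) hv
      refine Prod.ext ?_ (Prod.ext ?_ ?_)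
      · ext i
        have := hi ⟨i.1 + 1, by omega⟩
        simpa [lam] using this
      · simpa [lam] using hi ⟨0, by omega⟩
      · ext i
        have := hi ⟨i.1 + (n + 1), by omega⟩
        simpa [lam, show ¬ i.1 + (n + 1) ≤ n by omega] using this
  refine ⟨κ, lam, hκ, map_zero κ, hlam, Filter.Eventually.of_forall fun p => ?_⟩
  ext i
  simp only [lam, κ, crossCapForm, whitneyUmbrella, LinearMap.coe_mk, AddHom.coe_mk]
  split_ifs with h0 hi
  · simp
  · have : (⟨i.1, hi⟩ : Fin (n + 1)) = Fin.succ ⟨i.1 - 1, by omega⟩ := by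
      ext; simp; omega
    rw [this, Fin.cons_succ]
  · have : (⟨i.1 - (n + 1) + 1, by omega⟩ : Fin (n + 1)) = Fin.succ ⟨i.1 - (n + 1), by omega⟩ := rfl
    rw [this, Fin.cons_succ]
    rfl

theorem contDiff_crossCapForm (m : ℕ) : ContDiff ℝ ∞ (crossCapForm m) := by
  refine contDiff_euclidean.2 fun i => ?_
  have hx : ∀ j : Fin m, ContDiff ℝ ∞ fun x : EuclideanSpace ℝ (Fin m) => x j := fun j =>
    (EuclideanSpace.proj (𝕜 := ℝ) j).contDiff
  simp only [crossCapForm]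
  split_ifs
  · exact (hx _).pow 2
  · exact hx _
  · exact (hx _).mul (hx _)

end CrossCapForm

/-! ### Coordinate systems on the zero set -/

section Charts

variable {N l m : ℕ}

theorem rank_jacobian {k : ℕ} (g : EuclideanSpace ℝ (Fin N) → EuclideanSpace ℝ (Fin k))
    (x : EuclideanSpace ℝ (Fin N)) :
    (jacobian g x).rank = Module.finrank ℝ (LinearMap.range (fderiv ℝ g x).toLinearMap) := by
  have h : (jacobian g x).mulVecLin = ((WithLp.linearEquiv 2 ℝ (Fin k → ℝ)).toLinearMap.comp
      (fderiv ℝ g x).toLinearMap).comp (WithLp.linearEquiv 2 ℝ (Fin N → ℝ)).symm.toLinearMap := by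
    refine LinearMap.ext fun v => ?_
    exact jacobian_mulVec g x (WithLp.toLp 2 v)
  rw [Matrix.rank, h, LinearEquiv.range_comp, LinearMap.range_comp]
  exact LinearEquiv.finrank_map_eq _ _

theorem finrank_tangentZeroSet {h : EuclideanSpace ℝ (Fin N) → EuclideanSpace ℝ (Fin l)}
    (hN : N = m + l) {x : EuclideanSpace ℝ (Fin N)}
    (hx : (jacobian h x).rank = l) : Module.finrank ℝ (tangentZeroSet h x) = m := by
  have h1 := LinearMap.finrank_range_add_finrank_ker (fderiv ℝ h x).toLinearMap
  rw [← rank_jacobian, hx, finrank_euclideanSpace_fin] at h1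
  change l + Module.finrank ℝ (tangentZeroSet h x) = N at h1
  omega

/-- Near a regular point, the zero set has a smooth coordinate system. -/
theorem exists_isSmoothCoord {h : EuclideanSpace ℝ (Fin N) → EuclideanSpace ℝ (Fin l)}
    (hN : N = m + l) (hh : ContDiff ℝ ∞ h) (p : zeroSet h)
    (hp : (jacobian h p).rank = l) :
    ∃ φ : OpenPartialHomeomorph (zeroSet h) (EuclideanSpace ℝ (Fin m)),
      IsSmoothCoord (zeroSet h) φ ∧ p ∈ φ.source ∧ φ p = 0 := by
  let x : EuclideanSpace ℝ (Fin N) := p.1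
  change (jacobian h x).rank = l at hp
  have hT : Module.finrank ℝ (tangentZeroSet h x) = m := finrank_tangentZeroSet hN hp
  -- a projection that is an isomorphism on the tangent space completes `h` to a local
  -- diffeomorphism of the ambient space
  let e : tangentZeroSet h x ≃ₗ[ℝ] EuclideanSpace ℝ (Fin m) :=
    LinearEquiv.ofFinrankEq _ _ (by rw [hT, finrank_euclideanSpace_fin])
  obtain ⟨π', hπ'⟩ := LinearMap.exists_extend e.toLinearMap
  let π : EuclideanSpace ℝ (Fin N) →L[ℝ] EuclideanSpace ℝ (Fin m) := π'.toContinuousLinearMap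
  have hπ : ∀ v : tangentZeroSet h x, π v = e v := fun v => DFunLike.congr_fun hπ' v
  let χ : EuclideanSpace ℝ (Fin N) → EuclideanSpace ℝ (Fin l) × EuclideanSpace ℝ (Fin m) :=
    fun y => (h y, π (y - x))
  have hχs : ContDiff ℝ ∞ χ := hh.prodMk (π.contDiff.comp (contDiff_id.sub contDiff_const))
  have hχd : HasFDerivAt χ ((fderiv ℝ h x).prod π) x :=
    (hh.smoothNear (x := x)).hasFDerivAt.prodMk
      (π.hasFDerivAt.comp x ((hasFDerivAt_id x).sub_const x))
  have hχ : IsDiffeoGerm χ x := by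
    refine IsDiffeoGerm.of_hasFDerivAt ?_ hχs.smoothNear hχd fun v hv => ?_
    · rw [Module.finrank_prod, finrank_euclideanSpace_fin, finrank_euclideanSpace_fin,
        finrank_euclideanSpace_fin, hN, add_comm]
    · simp only [ContinuousLinearMap.prod_apply, Prod.mk_eq_zero] at hv
      obtain ⟨hv1, hv2⟩ := hv
      have h1 := hπ ⟨v, hv1⟩
      rw [hv2] at h1
      have h2 : (⟨v, hv1⟩ : tangentZeroSet h x) = 0 := e.injective (by rw [← h1, map_zero])
      exact congrArg Subtype.val h2
  obtain ⟨Φ, hΦχ, hxΦ, hΦ⟩ := hχ.exists_openPartialHomeomorph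
  classical
  let inv : EuclideanSpace ℝ (Fin m) → zeroSet h := fun y =>
    if hy : h (Φ.symm (0, y)) = 0 then ⟨Φ.symm (0, y), hy⟩ else p
  have hinv : ∀ y, (0, y) ∈ Φ.target → (inv y : EuclideanSpace ℝ (Fin N)) = Φ.symm (0, y) := by
    intro y hy
    have h1 : χ (Φ.symm (0, y)) = (0, y) := by rw [← hΦχ, Φ.right_inv hy]
    have h2 : h (Φ.symm (0, y)) = 0 := congrArg Prod.fst h1
    simp only [inv, dif_pos h2]
  have hzero : ∀ q : zeroSet h, χ q = (0, π (q - x)) := fun q => Prod.ext q.2 rfl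
  have hin : Continuous fun y : EuclideanSpace ℝ (Fin m) => ((0 : EuclideanSpace ℝ (Fin l)), y) := by
    fun_prop
  let φ : OpenPartialHomeomorph (zeroSet h) (EuclideanSpace ℝ (Fin m)) :=
    { toFun := fun q => π (q - x)
      invFun := inv
      source := {q | (q : EuclideanSpace ℝ (Fin N)) ∈ Φ.source}
      target := {y | (0, y) ∈ Φ.target}
      map_source' := fun q hq => by
        have := Φ.map_source hq
        rwa [hΦχ, hzero] at this
      map_target' := fun y hy => by
        change (inv y : EuclideanSpace ℝ (Fin N)) ∈ Φ.source
        rw [hinv y hy]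
        exact Φ.map_target hy
      left_inv' := fun q hq => by
        refine Subtype.ext ?_
        have h1 := Φ.map_source hq
        have h2 := Φ.left_inv hq
        rw [hΦχ, hzero] at h1 h2
        rw [hinv _ h1, h2]
      right_inv' := fun y hy => by
        have h1 : χ (Φ.symm (0, y)) = (0, y) := by rw [← hΦχ, Φ.right_inv hy]
        rw [hinv y hy]
        exact congrArg Prod.snd h1
      open_source := Φ.open_source.preimage continuous_subtype_val
      open_target := Φ.open_target.preimage hin
      continuousOn_toFun := by fun_prop
      continuousOn_invFun := by
        rw [Topology.IsInducing.subtypeVal.continuousOn_iff]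
        refine ContinuousOn.congr (f := fun y => Φ.symm (0, y)) ?_ fun y hy => hinv y hy
        exact Φ.continuousOn_symm.comp hin.continuousOn fun y hy => hy }
  have hsymm : ∀ y ∈ φ.target, (fun y => (φ.symm y : EuclideanSpace ℝ (Fin N))) =ᶠ[𝓝 y]
      fun y => Φ.symm (0, y) := by
    intro y hy
    filter_upwards [φ.open_target.mem_nhds hy] with z hz
    exact hinv z hz
  have hΦsymm : ∀ y ∈ φ.target, ContDiffAt ℝ ∞ Φ.symm (0, y) := by
    intro y hy
    have h1 := (hΦ _ (Φ.map_target hy)).2.2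
    rwa [← hΦχ, Φ.right_inv hy] at h1
  have hsm : ∀ y ∈ φ.target, ContDiffAt ℝ ∞
      (fun y => (φ.symm y : EuclideanSpace ℝ (Fin N))) y := by
    intro y hy
    refine ContDiffAt.congr_of_eventuallyEq ?_ (hsymm y hy)
    exact (hΦsymm y hy).comp y (contDiff_const.prodMk contDiff_id).contDiffAt
  refine ⟨φ, ⟨fun y hy => (hsm y hy).contDiffWithinAt, fun y hy => ?_⟩, hxΦ, ?_⟩
  · have h1 : HasFDerivAt (fun z => (φ.symm z : EuclideanSpace ℝ (Fin N)))
        (fderiv ℝ (fun z => (φ.symm z : EuclideanSpace ℝ (Fin N))) y) y :=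
      ((hsm y hy).differentiableAt (by simp)).hasFDerivAt
    have h2 : HasFDerivAt (fun z => π ((φ.symm z : EuclideanSpace ℝ (Fin N)) - x)) _ y :=
      π.hasFDerivAt.comp y (h1.sub_const x)
    have h3 : (fun z => π ((φ.symm z : EuclideanSpace ℝ (Fin N)) - x)) =ᶠ[𝓝 y] fun z => z := by
      filter_upwards [φ.open_target.mem_nhds hy] with z hz
      exact φ.right_inv hz
    have h4 := (h2.congr_of_eventuallyEq h3.symm).unique (hasFDerivAt_id y)
    intro a b hab
    have ha := DFunLike.congr_fun h4 a
    have hb := DFunLike.congr_fun h4 b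
    simp only [ContinuousLinearMap.comp_apply, ContinuousLinearMap.id_apply] at ha hb
    rw [← ha, ← hb, hab]
  · change π (x - x) = 0
    simp

/-- A smooth coordinate system followed by a local diffeomorphism. -/
theorem IsSmoothCoord.trans {M : Set (EuclideanSpace ℝ (Fin N))}
    {φ : OpenPartialHomeomorph M (EuclideanSpace ℝ (Fin m))} (hφ : IsSmoothCoord M φ)
    {Ψ : OpenPartialHomeomorph (EuclideanSpace ℝ (Fin m)) (EuclideanSpace ℝ (Fin m))}
    (hΨ : ∀ y ∈ Ψ.source, ContDiffAt ℝ ∞ Ψ y ∧ ContDiffAt ℝ ∞ Ψ.symm (Ψ y)) :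
    IsSmoothCoord M (φ.trans Ψ) := by
  have hsymm : ∀ y ∈ Ψ.target, ContDiffAt ℝ ∞ Ψ.symm y := by
    intro y hy
    have := (hΨ _ (Ψ.map_target hy)).2
    rwa [Ψ.right_inv hy] at this
  have hφs : ∀ y ∈ φ.target, ContDiffAt ℝ ∞ (fun x => (φ.symm x : EuclideanSpace ℝ (Fin N))) y :=
    fun y hy => hφ.contDiffOn_symm.contDiffAt (φ.open_target.mem_nhds hy)
  have htar : ∀ y ∈ (φ.trans Ψ).target, y ∈ Ψ.target ∧ Ψ.symm y ∈ φ.target := by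
    intro y hy
    rw [OpenPartialHomeomorph.trans_target] at hy
    exact hy
  refine ⟨fun y hy => ?_, fun y hy => ?_⟩
  · obtain ⟨h1, h2⟩ := htar y hy
    exact ((hφs _ h2).comp y (hsymm y h1)).contDiffWithinAt
  · obtain ⟨h1, h2⟩ := htar y hy
    have h3 : HasFDerivAt (fun y => ((φ.trans Ψ).symm y : EuclideanSpace ℝ (Fin N))) _ y :=
      HasFDerivAt.comp (g := fun x => (φ.symm x : EuclideanSpace ℝ (Fin N))) y
        ((hφs _ h2).differentiableAt (by simp)).hasFDerivAt
        ((hsymm y h1).differentiableAt (by simp)).hasFDerivAt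
    rw [h3.fderiv]
    have h4 : HasFDerivAt (fun z => Ψ (Ψ.symm z)) _ y :=
      (((hΨ _ (Ψ.map_target h1)).1).differentiableAt (by simp)).hasFDerivAt.comp y
        ((hsymm y h1).differentiableAt (by simp)).hasFDerivAt
    have h5 : (fun z => Ψ (Ψ.symm z)) =ᶠ[𝓝 y] fun z => z := by
      filter_upwards [Ψ.open_target.mem_nhds h1] with z hz
      exact Ψ.right_inv hz
    have h6 := (h4.congr_of_eventuallyEq h5.symm).unique (hasFDerivAt_id y)
    refine (hφ.injective_fderiv _ h2).comp fun a b hab => ?_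
    have ha := DFunLike.congr_fun h6 a
    have hb := DFunLike.congr_fun h6 b
    simp only [ContinuousLinearMap.comp_apply, ContinuousLinearMap.id_apply] at ha hb
    rw [← ha, ← hb]
    exact congrArg _ hab

theorem IsSmoothCoord.smoothNear {M : Set (EuclideanSpace ℝ (Fin N))}
    {φ : OpenPartialHomeomorph M (EuclideanSpace ℝ (Fin m))} (hφ : IsSmoothCoord M φ)
    {y : EuclideanSpace ℝ (Fin m)} (hy : y ∈ φ.target) :
    SmoothNear (fun x => (φ.symm x : EuclideanSpace ℝ (Fin N))) y := by
  filter_upwards [φ.open_target.mem_nhds hy] with z hz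
  exact hφ.contDiffOn_symm.contDiffAt (φ.open_target.mem_nhds hz)

/-- In terms of germs: the local expression of a map at a cross-cap is equivalent to
`crossCapForm`. -/
theorem IsCrossCap.exists_germEquiv {M : Set (EuclideanSpace ℝ (Fin N))} {p : M}
    {f : EuclideanSpace ℝ (Fin N) → EuclideanSpace ℝ (Fin (2 * m - 1))}
    (h : IsCrossCap M (M.domRestrict f) p) :
    ∃ φ : OpenPartialHomeomorph M (EuclideanSpace ℝ (Fin m)), IsSmoothCoord M φ ∧ p ∈ φ.source ∧
      φ p = 0 ∧ GermEquiv (fun y => f (φ.symm y)) 0 (crossCapForm m) 0 := by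
  obtain ⟨φ, ψ, hφ, hp, hp0, hψ, hψs, hfp, -, he⟩ := h
  have hsymm : φ.symm 0 = p := by rw [← hp0, φ.left_inv hp]
  refine ⟨φ, hφ, hp, hp0, fun y => y, ψ, isDiffeoGerm_id _, rfl, ?_, ?_⟩
  · simp only [hsymm]
    change f p ∈ ψ.source at hfp
    have h1 : SmoothNear ψ (f p) := by
      filter_upwards [ψ.open_source.mem_nhds hfp] with z hz
      exact hψ.contDiffAt (ψ.open_source.mem_nhds hz)
    refine IsDiffeoGerm.of_hasFDerivAt rfl h1 h1.hasFDerivAt fun v hv => ?_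
    have h2 : HasFDerivAt ψ.symm _ (ψ (f p)) :=
      ((hψs.contDiffAt (ψ.open_target.mem_nhds (ψ.map_source hfp))).differentiableAt
        (by simp)).hasFDerivAt
    have h3 : (fun z => ψ.symm (ψ z)) =ᶠ[𝓝 (f p)] fun z => z := ψ.eventually_left_inverse hfp
    have h4 := ((h2.comp (f p) h1.hasFDerivAt).congr_of_eventuallyEq h3.symm).unique
      (hasFDerivAt_id (f p))
    have h5 := DFunLike.congr_fun h4 v
    simp only [ContinuousLinearMap.comp_apply, ContinuousLinearMap.id_apply, hv, map_zero] at h5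
    exact h5.symm
  · filter_upwards [he] with y hy
    exact hy.2.2

theorem isCrossCap_of_germEquiv {M : Set (EuclideanSpace ℝ (Fin N))} {p : M}
    {f : EuclideanSpace ℝ (Fin N) → EuclideanSpace ℝ (Fin (2 * m - 1))} (hf : Continuous f)
    {φ : OpenPartialHomeomorph M (EuclideanSpace ℝ (Fin m))} (hφ : IsSmoothCoord M φ)
    (hp : p ∈ φ.source) (hp0 : φ p = 0)
    (h : GermEquiv (fun y => f (φ.symm y)) 0 (crossCapForm m) 0) :
    IsCrossCap M (M.domRestrict f) p := by
  obtain ⟨χ, ψ, hχ, hχ0, hψ, he⟩ := h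
  have hsymm : φ.symm 0 = p := by rw [← hp0, φ.left_inv hp]
  obtain ⟨Ψ, hΨχ, h0Ψ, hΨ⟩ := hχ.exists_openPartialHomeomorph
  obtain ⟨Θ, hΘψ, h0Θ, hΘ⟩ := hψ.exists_openPartialHomeomorph
  simp only [hsymm] at h0Θ
  have hp' : p ∈ (φ.trans Ψ).source := by
    rw [OpenPartialHomeomorph.trans_source]
    exact ⟨hp, by rw [Set.mem_preimage, hp0]; exact h0Ψ⟩
  have hp0' : (φ.trans Ψ) p = 0 := by
    rw [OpenPartialHomeomorph.trans_apply, hp0, hΨχ, hχ0]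
  have htend : Filter.Tendsto Ψ.symm (𝓝 0) (𝓝 0) := by
    have := Ψ.tendsto_symm h0Ψ
    rwa [hΨχ, hχ0] at this
  refine ⟨φ.trans Ψ, Θ, hφ.trans fun y hy => ?_, hp', hp0', fun z hz => ?_, fun z hz => ?_,
    h0Θ, ?_, ?_⟩
  · have := hΨ y hy
    rw [← hΨχ] at this
    exact ⟨this.1, this.2.2⟩
  · rw [hΘψ]
    exact (hΘ z hz).1.contDiffWithinAt
  · have := (hΘ _ (Θ.map_target hz)).2.2
    rw [← hΘψ, Θ.right_inv hz] at this
    exact this.contDiffWithinAt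
  · have := he.self_of_nhds
    simp only [hsymm, hχ0] at this
    change Θ (f p) = 0
    rw [hΘψ, this]
    ext i
    simp [crossCapForm]
  · have h1 : ∀ᶠ x in 𝓝 (0 : EuclideanSpace ℝ (Fin m)), x ∈ (φ.trans Ψ).target := by
      rw [← hp0']
      exact (φ.trans Ψ).open_target.mem_nhds ((φ.trans Ψ).map_source hp')
    have h2 : ∀ᶠ x in 𝓝 (0 : EuclideanSpace ℝ (Fin m)),
        f ((φ.trans Ψ).symm x) ∈ Θ.source := by
      have h3 := (φ.trans Ψ).tendsto_symm hp'
      rw [hp0'] at h3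
      exact ((hf.comp continuous_subtype_val).continuousAt.tendsto.comp h3).eventually
        (Θ.open_source.mem_nhds h0Θ)
    have h3 : ∀ᶠ x in 𝓝 (0 : EuclideanSpace ℝ (Fin m)), χ (Ψ.symm x) = x := by
      have := Ψ.eventually_right_inverse (Ψ.map_source h0Ψ)
      rwa [hΨχ, hχ0] at this
    filter_upwards [h1, h2, h3, htend.eventually he] with x h1 h2 h3 h4
    refine ⟨h1, h2, ?_⟩
    rw [h3] at h4
    rw [hΘψ]
    exact h4

end Charts

/-! ### Ranks and regular zeros on the zero set -/

section Rank

variable {N l k m : ℕ} {h : EuclideanSpace ℝ (Fin N) → EuclideanSpace ℝ (Fin l)}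
  {f : EuclideanSpace ℝ (Fin N) → EuclideanSpace ℝ (Fin k)}

/-- The linear map `(a, b) ↦ (a₁, …, a_l, b₁, …, b_k)`. -/
noncomputable def appendCLM (l k : ℕ) : EuclideanSpace ℝ (Fin l) × EuclideanSpace ℝ (Fin k) →L[ℝ]
    EuclideanSpace ℝ (Fin (l + k)) :=
  LinearMap.toContinuousLinearMap
    { toFun := fun q => WithLp.toLp 2 (Fin.append q.1 q.2)
      map_add' := fun p q => by
        ext i
        refine Fin.addCases (fun i => ?_) (fun i => ?_) i <;> simp
      map_smul' := fun c p => by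
        ext i
        refine Fin.addCases (fun i => ?_) (fun i => ?_) i <;> simp }

theorem appendCLM_injective (l k : ℕ) : Function.Injective (appendCLM l k) := by
  refine (injective_iff_map_eq_zero _).2 fun q hq => Prod.ext ?_ ?_
  · ext i
    have := congrArg (fun w : EuclideanSpace ℝ (Fin (l + k)) => w (Fin.castAdd k i)) hq
    simpa [appendCLM] using this
  · ext i
    have := congrArg (fun w : EuclideanSpace ℝ (Fin (l + k)) => w (Fin.natAdd l i)) hq
    simpa [appendCLM] using this

theorem contDiff_pairMap (hh : ContDiff ℝ ∞ h) (hf : ContDiff ℝ ∞ f) :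
    ContDiff ℝ ∞ (pairMap h f) :=
  (appendCLM l k).contDiff.comp (hh.prodMk hf)

theorem fderiv_pairMap (hh : ContDiff ℝ ∞ h) (hf : ContDiff ℝ ∞ f)
    (x v : EuclideanSpace ℝ (Fin N)) :
    fderiv ℝ (pairMap h f) x v = appendCLM l k (fderiv ℝ h x v, fderiv ℝ f x v) := by
  have h1 : HasFDerivAt (pairMap h f) _ x :=
    (appendCLM l k).hasFDerivAt.comp x
      ((hh.smoothNear (x := x)).hasFDerivAt.prodMk (hf.smoothNear (x := x)).hasFDerivAt)
  rw [h1.fderiv]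
  rfl

theorem fderiv_pairMap_eq_zero_iff (hh : ContDiff ℝ ∞ h) (hf : ContDiff ℝ ∞ f)
    {x v : EuclideanSpace ℝ (Fin N)} :
    fderiv ℝ (pairMap h f) x v = 0 ↔ fderiv ℝ h x v = 0 ∧ fderiv ℝ f x v = 0 := by
  rw [fderiv_pairMap hh hf, map_eq_zero_iff _ (appendCLM_injective l k), Prod.mk_eq_zero]

theorem rankOnZeroSet_add_finrank_ker {ι : Type*} [Fintype ι] (hN : N = m + l)
    {x : EuclideanSpace ℝ (Fin N)} (hx : (jacobian h x).rank = l)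
    (g : EuclideanSpace ℝ (Fin N) → EuclideanSpace ℝ ι) :
    rankOnZeroSet h g x + Module.finrank ℝ
      (LinearMap.ker ((fderiv ℝ g x).toLinearMap.domRestrict (tangentZeroSet h x))) = m := by
  rw [← finrank_tangentZeroSet hN hx]
  exact LinearMap.finrank_range_add_finrank_ker _

theorem rankOnZeroSet_eq_iff {ι : Type*} [Fintype ι] (hN : N = m + l)
    {x : EuclideanSpace ℝ (Fin N)} (hx : (jacobian h x).rank = l)
    (g : EuclideanSpace ℝ (Fin N) → EuclideanSpace ℝ ι) :
    rankOnZeroSet h g x = m ↔ ∀ v, fderiv ℝ h x v = 0 → fderiv ℝ g x v = 0 → v = 0 := by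
  have h1 := rankOnZeroSet_add_finrank_ker hN hx g
  have h2 : rankOnZeroSet h g x = m ↔ Module.finrank ℝ
      (LinearMap.ker ((fderiv ℝ g x).toLinearMap.domRestrict (tangentZeroSet h x))) = 0 := by
    omega
  rw [h2, Submodule.finrank_eq_zero, LinearMap.ker_eq_bot']
  constructor
  · intro h3 v hv1 hv2
    exact congrArg Subtype.val (h3 ⟨v, hv1⟩ hv2)
  · rintro h3 ⟨v, hv1⟩ hv2
    exact Subtype.ext (h3 v hv1 hv2)

theorem finrank_ker_pairMap (hh : ContDiff ℝ ∞ h) (hf : ContDiff ℝ ∞ f)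
    (x : EuclideanSpace ℝ (Fin N)) :
    Module.finrank ℝ (LinearMap.ker ((fderiv ℝ f x).toLinearMap.domRestrict (tangentZeroSet h x))) =
      Module.finrank ℝ (LinearMap.ker (fderiv ℝ (pairMap h f) x).toLinearMap) := by
  rw [← Submodule.finrank_map_subtype_eq (tangentZeroSet h x)]
  refine congrArg (fun S : Submodule ℝ (EuclideanSpace ℝ (Fin N)) => Module.finrank ℝ S) ?_
  ext v
  have := fderiv_pairMap_eq_zero_iff hh hf (x := x) (v := v)
  constructor
  · rintro ⟨⟨w, hw1⟩, hw2, rfl⟩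
    exact this.2 ⟨hw1, hw2⟩
  · intro hv
    obtain ⟨h1, h2⟩ := this.1 hv
    exact ⟨⟨v, h1⟩, h2, rfl⟩

theorem rankOnZeroSet_eq_sub_one_iff (hN : N = m + l) (hm : 1 ≤ m) (hh : ContDiff ℝ ∞ h)
    (hf : ContDiff ℝ ∞ f) {x : EuclideanSpace ℝ (Fin N)} (hx : (jacobian h x).rank = l) :
    rankOnZeroSet h f x = m - 1 ↔ (jacobian (pairMap h f) x).rank = m - 1 + l := by
  have h1 := rankOnZeroSet_add_finrank_ker hN hx f
  have h2 := LinearMap.finrank_range_add_finrank_ker (fderiv ℝ (pairMap h f) x).toLinearMap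
  rw [finrank_ker_pairMap hh hf] at h1
  rw [← rank_jacobian, finrank_euclideanSpace_fin] at h2
  omega

/-- The tangent space is parametrised by the derivative of the inverse of a coordinate system. -/
theorem IsSmoothCoord.fderiv_eq_zero_iff {φ : OpenPartialHomeomorph (zeroSet h)
    (EuclideanSpace ℝ (Fin m))} (hφ : IsSmoothCoord (zeroSet h) φ) (hN : N = m + l)
    (hh : ContDiff ℝ ∞ h) {y : EuclideanSpace ℝ (Fin m)} (hy : y ∈ φ.target)
    (hx : (jacobian h (φ.symm y)).rank = l) (v : EuclideanSpace ℝ (Fin N)) :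
    fderiv ℝ h (φ.symm y) v = 0 ↔
      ∃ a, fderiv ℝ (fun z => (φ.symm z : EuclideanSpace ℝ (Fin N))) y a = v := by
  set L := fderiv ℝ (fun z => (φ.symm z : EuclideanSpace ℝ (Fin N))) y with hL
  have h1 : LinearMap.range L.toLinearMap ≤ tangentZeroSet h (φ.symm y) := by
    rintro _ ⟨a, rfl⟩
    have h2 : HasFDerivAt (fun z => h (φ.symm z)) _ y :=
      HasFDerivAt.comp (f := fun z => (φ.symm z : EuclideanSpace ℝ (Fin N))) y
        (hh.smoothNear (x := (φ.symm y : EuclideanSpace ℝ (Fin N)))).hasFDerivAt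
        (hφ.smoothNear hy).hasFDerivAt
    have h3 : (fun z => h (φ.symm z)) = fun _ => 0 := funext fun z => (φ.symm z).2
    rw [h3] at h2
    exact DFunLike.congr_fun (h2.unique (hasFDerivAt_const _ _)) a
  have h2 : LinearMap.range L.toLinearMap = tangentZeroSet h (φ.symm y) := by
    refine Submodule.eq_of_le_of_finrank_eq h1 ?_
    rw [finrank_tangentZeroSet hN hx,
      LinearMap.finrank_range_of_inj (f := L.toLinearMap) (hφ.injective_fderiv y hy),
      finrank_euclideanSpace_fin]
  have h3 := SetLike.ext_iff.1 h2 v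
  exact h3.symm

/-- The rank on the zero set is the rank in a coordinate system. -/
theorem IsSmoothCoord.finrank_range_fderiv {φ : OpenPartialHomeomorph (zeroSet h)
    (EuclideanSpace ℝ (Fin m))} (hφ : IsSmoothCoord (zeroSet h) φ) (hN : N = m + l)
    (hh : ContDiff ℝ ∞ h) (hf : ContDiff ℝ ∞ f) {y : EuclideanSpace ℝ (Fin m)} (hy : y ∈ φ.target)
    (hx : (jacobian h (φ.symm y)).rank = l) :
    Module.finrank ℝ (LinearMap.range (fderiv ℝ (fun z => f (φ.symm z)) y).toLinearMap) =
      rankOnZeroSet h f (φ.symm y) := by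
  have h2 : HasFDerivAt (fun z => f (φ.symm z)) _ y :=
    HasFDerivAt.comp (f := fun z => (φ.symm z : EuclideanSpace ℝ (Fin N))) y
      (hf.smoothNear (x := (φ.symm y : EuclideanSpace ℝ (Fin N)))).hasFDerivAt
      (hφ.smoothNear hy).hasFDerivAt
  rw [rankOnZeroSet, h2.fderiv]
  refine congrArg (fun S : Submodule ℝ (EuclideanSpace ℝ (Fin k)) => Module.finrank ℝ S) ?_
  ext z
  constructor
  · rintro ⟨a, rfl⟩
    exact ⟨⟨_, (hφ.fderiv_eq_zero_iff hN hh hy hx _).2 ⟨a, rfl⟩⟩, rfl⟩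
  · rintro ⟨⟨v, hv⟩, rfl⟩
    obtain ⟨a, ha⟩ := (hφ.fderiv_eq_zero_iff hN hh hy hx v).1 hv
    exact ⟨a, congrArg (fderiv ℝ f (φ.symm y)) ha⟩

/-- In a coordinate system of the zero set, the regularity of the zero of the maximal minors is the
non-degeneracy of the second derivative. -/
theorem isNondegenerateAt_iff_isRegularZeroOnZeroSet (hN : N = m + l) (hm : 1 ≤ m)
    (hh : ContDiff ℝ ∞ h) (hf : ContDiff ℝ ∞ f) {p : zeroSet h} (hp : (jacobian h p).rank = l)
    (hr : rankOnZeroSet h f p = m - 1)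
    {φ : OpenPartialHomeomorph (zeroSet h) (EuclideanSpace ℝ (Fin m))}
    (hφ : IsSmoothCoord (zeroSet h) φ) (hps : p ∈ φ.source) (hp0 : φ p = 0) :
    IsNondegenerateAt (fun y => f (φ.symm y)) 0 ↔
      IsRegularZeroOnZeroSet m h (fun x => maximalMinors (jacobian (pairMap h f) x)) p := by
  have hsymm : φ.symm 0 = p := by rw [← hp0, φ.left_inv hps]
  have h0 : (0 : EuclideanSpace ℝ (Fin m)) ∈ φ.target := by rw [← hp0]; exact φ.map_source hps
  obtain ⟨x, hx⟩ := p
  let γ : EuclideanSpace ℝ (Fin m) → EuclideanSpace ℝ (Fin N) := fun y => φ.symm y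
  have hγ0 : γ 0 = x := congrArg Subtype.val hsymm
  have hγ : SmoothNear γ 0 := hφ.smoothNear h0
  have hγT : ∀ v, fderiv ℝ h x v = 0 ↔ ∃ a, fderiv ℝ γ 0 a = v := by
    intro v
    have := hφ.fderiv_eq_zero_iff hN hh h0 (by rw [hsymm]; exact hp) v
    rw [hsymm] at this
    exact this
  have hγinj : ∀ a, fderiv ℝ γ 0 a = 0 → a = 0 := fun a ha =>
    hφ.injective_fderiv 0 h0 (by rw [map_zero]; exact ha)
  change IsNondegenerateAt (fun y => f (γ y)) 0 ↔ IsRegularZeroOnZeroSet m h _ x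
  change (jacobian h x).rank = l at hp
  change rankOnZeroSet h f x = m - 1 at hr
  set G := pairMap h f with hGdef
  have hG : ContDiff ℝ ∞ G := contDiff_pairMap hh hf
  have hfγ : SmoothNear (fun y => f (γ y)) 0 := SmoothNear.comp (f := γ) hf.smoothNear hγ
  let J : EuclideanSpace ℝ (Fin k) →L[ℝ] EuclideanSpace ℝ (Fin (l + k)) :=
    (appendCLM l k).comp (ContinuousLinearMap.inr ℝ _ _)
  obtain ⟨d1, d2⟩ := fderiv_fderiv_of_eventuallyEq_comp (g := fun y => f (γ y)) (g' := G) (χ := γ)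
    (ψ := J) hfγ hG.smoothNear hγ J.contDiff.smoothNear (Filter.Eventually.of_forall fun y => by
      have : h (γ y) = 0 := (φ.symm y).2
      change appendCLM l k (0, f (γ y)) = appendCLM l k (h (γ y), f (γ y))
      rw [this])
  rw [J.fderiv, hγ0] at d1 d2
  have hJr : ∀ z w, fderiv ℝ G x w = J z ↔ fderiv ℝ h x w = 0 ∧ fderiv ℝ f x w = z := by
    intro z w
    rw [fderiv_pairMap hh hf]
    change _ = appendCLM l k (0, z) ↔ _
    rw [(appendCLM_injective l k).eq_iff, Prod.mk.injEq]
  have hfγd : ∀ a, fderiv ℝ (fun y => f (γ y)) 0 a = fderiv ℝ f x (fderiv ℝ γ 0 a) := fun a =>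
    ((hJr _ _).1 (d1 a).symm).2.symm
  -- the kernel of `dG` is a line
  have hker1 : Module.finrank ℝ (LinearMap.ker (fderiv ℝ G x).toLinearMap) = 1 := by
    have h1 := rankOnZeroSet_add_finrank_ker hN hp f
    rw [finrank_ker_pairMap hh hf, hr, ← hGdef] at h1
    omega
  obtain ⟨⟨v, hvG⟩, hv, hspan⟩ := finrank_eq_one_iff'.1 hker1
  have hv : v ≠ 0 := fun h => hv (Subtype.ext h)
  replace hvG : fderiv ℝ G x v = 0 := hvG
  have hker : ∀ w, fderiv ℝ G x w = 0 ↔ ∃ c : ℝ, w = c • v := by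
    intro w
    constructor
    · intro hw
      obtain ⟨c, hc⟩ := hspan ⟨w, hw⟩
      exact ⟨c, (congrArg Subtype.val hc).symm⟩
    · rintro ⟨c, rfl⟩
      rw [map_smul, hvG, smul_zero]
  obtain ⟨a, ha⟩ := (hγT v).1 ((fderiv_pairMap_eq_zero_iff hh hf).1 hvG).1
  have ha0 : a ≠ 0 := by
    rintro rfl
    exact hv (by rw [← ha, map_zero])
  have hfa : fderiv ℝ (fun y => f (γ y)) 0 a = 0 := by
    rw [hfγd, ha, ((fderiv_pairMap_eq_zero_iff hh hf).1 hvG).2]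
  have hfker : ∀ b, fderiv ℝ (fun y => f (γ y)) 0 b = 0 → ∃ c : ℝ, b = c • a := by
    intro b hb
    have h1 : fderiv ℝ G x (fderiv ℝ γ 0 b) = 0 := by rw [← d1, hb, map_zero]
    obtain ⟨c, hc⟩ := (hker _).1 h1
    refine ⟨c, sub_eq_zero.1 (hγinj _ ?_)⟩
    rw [map_sub, map_smul, ha, hc, sub_self]
  -- second derivatives correspond to each other
  have hsec : ∀ b, fderiv ℝ (fun y => fderiv ℝ (fun y => f (γ y)) y a) 0 b ∈
      LinearMap.range (fderiv ℝ (fun y => f (γ y)) 0).toLinearMap ↔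
      fderiv ℝ (fun z => maximalMinors (jacobian G z)) x (fderiv ℝ γ 0 b) = 0 := by
    intro b
    rw [fderiv_maximalMinors_eq_zero_iff hG hv hker]
    obtain ⟨w, hw⟩ := d2 a hfa b
    rw [ha] at hw
    constructor
    · rintro ⟨c, hc⟩
      change fderiv ℝ (fun y => f (γ y)) 0 c = _ at hc
      rw [← hc, d1] at hw
      exact ⟨fderiv ℝ γ 0 c - w, by
        change fderiv ℝ G x _ = _
        rw [map_sub, hw, add_sub_cancel_right]⟩
    · rintro ⟨c, hc⟩
      change fderiv ℝ G x c = _ at hc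
      rw [← hc, ← map_add] at hw
      obtain ⟨h1, h2⟩ := (hJr _ _).1 hw.symm
      obtain ⟨e, he⟩ := (hγT _).1 h1
      refine ⟨e, ?_⟩
      change fderiv ℝ (fun y => f (γ y)) 0 e = _
      rw [hfγd, he, h2]
  rw [IsRegularZeroOnZeroSet, rankOnZeroSet_eq_iff hN hp]
  constructor
  · rintro ⟨-, hnd⟩
    refine ⟨maximalMinors_jacobian_eq_zero hv hvG, fun u hu1 hu2 => ?_⟩
    obtain ⟨b, rfl⟩ := (hγT u).1 hu1
    rw [hnd a ha0 hfa b ((hsec b).2 hu2), map_zero]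
  · rintro ⟨-, hreg⟩
    refine ⟨⟨a, ha0, hfa⟩, fun a' ha' hfa' b hb => ?_⟩
    obtain ⟨c, rfl⟩ := hfker a' hfa'
    have hc : c ≠ 0 := by
      rintro rfl
      exact ha' (zero_smul _ _)
    have h1 : fderiv ℝ (fun y => fderiv ℝ (fun y => f (γ y)) y (c • a)) 0 b =
        c • fderiv ℝ (fun y => fderiv ℝ (fun y => f (γ y)) y a) 0 b := by
      rw [fderiv_fderiv_apply hfγ, fderiv_fderiv_apply hfγ, map_smul]
    rw [h1, Submodule.smul_mem_iff _ hc, hsec] at hb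
    exact hγinj b (hreg _ ((hγT _).2 ⟨b, rfl⟩) hb)

end Rank

theorem proposition6p3 (m l : ℕ) (hm : 1 ≤ m)
    (h : EuclideanSpace ℝ (Fin (m + l)) → EuclideanSpace ℝ (Fin l))
    (f : EuclideanSpace ℝ (Fin (m + l)) → EuclideanSpace ℝ (Fin (2 * m - 1)))
    (hh : ContDiff ℝ ∞ h) (hf : ContDiff ℝ ∞ f)
    (hrank : ∀ x ∈ zeroSet h, (jacobian h x).rank = l)
    (p : zeroSet h) :
    (rankOnZeroSet h f p = m - 1 ↔ (jacobian (pairMap h f) p).rank = m - 1 + l) ∧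
    (rankOnZeroSet h f p = m - 1 →
      (IsCrossCap (zeroSet h) ((zeroSet h).domRestrict f) p ↔
        IsRegularZeroOnZeroSet m h (fun x => maximalMinors (jacobian (pairMap h f) x)) p)) := by
  have hp := hrank p p.2
  refine ⟨rankOnZeroSet_eq_sub_one_iff rfl hm hh hf hp, fun hr => ⟨fun hc => ?_, fun hreg => ?_⟩⟩
  · obtain ⟨φ, hφ, hps, hp0, he⟩ := hc.exists_germEquiv
    refine (isNondegenerateAt_iff_isRegularZeroOnZeroSet rfl hm hh hf hp hr hφ hps hp0).1 ?_
    obtain ⟨n, rfl⟩ : ∃ n, m = n + 1 := ⟨m - 1, by omega⟩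
    have h0 : (0 : EuclideanSpace ℝ (Fin (n + 1))) ∈ φ.target := by
      rw [← hp0]; exact φ.map_source hps
    have hs : SmoothNear (fun y => f (φ.symm y)) 0 :=
      SmoothNear.comp (f := fun y => (φ.symm y : EuclideanSpace ℝ (Fin (n + 1 + l))))
        hf.smoothNear (hφ.smoothNear h0)
    have h1 := (isNondegenerateAt_whitneyUmbrella (EuclideanSpace ℝ (Fin n))).of_germEquiv
      (contDiff_whitneyUmbrella _).smoothNear (contDiff_crossCapForm _).smoothNear
      (germEquiv_crossCapForm n)
    exact h1.of_germEquiv (contDiff_crossCapForm _).smoothNear hs (he.symm hs.continuousAt)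
  · obtain ⟨φ, hφ, hps, hp0⟩ := exists_isSmoothCoord rfl hh p hp
    have hnd := (isNondegenerateAt_iff_isRegularZeroOnZeroSet rfl hm hh hf hp hr hφ hps hp0).2 hreg
    refine isCrossCap_of_germEquiv hf.continuous hφ hps hp0 ?_
    obtain ⟨n, rfl⟩ : ∃ n, m = n + 1 := ⟨m - 1, by omega⟩
    have hsymm : φ.symm 0 = p := by rw [← hp0, φ.left_inv hps]
    have h0 : (0 : EuclideanSpace ℝ (Fin (n + 1))) ∈ φ.target := by
      rw [← hp0]; exact φ.map_source hps
    have hs : SmoothNear (fun y => f (φ.symm y)) 0 :=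
      SmoothNear.comp (f := fun y => (φ.symm y : EuclideanSpace ℝ (Fin (n + 1 + l))))
        hf.smoothNear (hφ.smoothNear h0)
    refine (germEquiv_whitneyUmbrella_of_isNondegenerateAt hs hnd finrank_euclideanSpace_fin
      (by rw [finrank_euclideanSpace_fin]; omega) ?_).trans (germEquiv_crossCapForm n)
    rw [hφ.finrank_range_fderiv rfl hh hf h0 (by rw [hsymm]; exact hp), hsymm, hr,
      Nat.add_sub_cancel]
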